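/- **Exponential fast-forwarding of permutation-invariant qubit Hamiltonians.** *Setting.* Let $\mathcal H_n=(\mathbb C^2)^{\otimes n}$. Fix $k\in\mathbb N$ and, for each $n$, a degree bound $g_n\in\mathbb N\cup\{\infty\}$ ($g_n=\infty$ meaning no bound). Let $\mathcal C_n$ be the class of $k$-local $n$-qubit Hamiltonians of degree at most $g_n$, i.e. operators $H=\sum_{X\subseteq\{1,\dots,n\}}h_X$ where each $h_X$ is Hermitian, acts only on the qubits in $X$ and satisfies $\|h_X\|\le 1$, where $|X|\le k$ whenever $h_X\ne 0$, and where each qubit lies in at most $g_n$ of the sets $X$ with $h_X\neq 0$. $H$ is permutation-invariant if it commutes with all permutations of the $n$ tensor factors. A circuit is a finite sequence of two-qubit gates (unitaries acting on at most two of the qubits), and its complexity is the number of gates. Circuits $\{V_n(t)\}_{n,t}$, $V_n(t)$ acting on $\mathcal H_n$ and a register $\mathcal A$ of finitely many ancilla qubits, *simulate* $\{H_n\}_n$ with parameters $(T(n),\epsilon(n),G(n))$ if for every $n\ge 1$ and every $0\le t\le T(n)$ the circuit $V_n(t)$ has at most $G(n)$ gates and $$\big\|(e^{-itH_n}\otimes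 \mathbb 1_{\mathcal A}-V_n(t))\,|\psi\rangle\otimes|0\cdots 0\rangle_{\mathcal A}\big\|\le\epsilon(n)\quad\text{for all unit vectors }|\psi\rangle\in\mathcal H_n .$$ The *no-fast-forwarding line* $l(n)$ of $\{\mathcal C_n\}_n$ for $T$ and $\epsilon$ is the maximum over $H\in\mathcal C_n$ of the least $G$ such that some circuits $\{V(t)\}_t$ simulate $H$ with parameters $(T(n),\epsilon(n),G)$. The circuits $\{V_n(t)\}_{n,t}$ are *$(T(n),\epsilon(n),G(n))$-fast-forwarding* $\{H_n\in\mathcal C_n\}_n$ if they simulate it with these parameters and $G(n)/l(n)\to 0$. The fast-forwarding is *exponential* if moreover $G(n)=O(\mathrm{poly}(n))$ while $l(n)=\Omega(b^n)$ for some $b>1$. *Theorem.* Let $\{H_n\in\mathcal C_n\}_{n\ge1}$ be a sequence of permutation-invariant Hamiltonians, let $\epsilon>0$ and $T(n)=2^{2n}=4^n$. There exist $G(n)=O(n^3)$ and circuits $\{V_n(t)\}_{n,t}$ of two-qubit gates that simulate $\{H_n\}_n$ on the whole spaces $\mathcal H_n$ with parameters $(T(n),\epsilon,G(n))$. With $l$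 the no-fast-forwarding line of $\{\mathcal C_n\}_n$ for $T$ and the constant error $\epsilon$: if $n^3/l(n)\to0$, these circuits are $(T(n),\epsilon,G(n))$-fast-forwarding $\{H_n\}_n$; if $l(n)=\Omega(b^n)$ for some $b>1$, the fast-forwarding is exponential; in particular, it is exponential if $l(n)=\Omega(n\,T(n))$. -/

import Mathlib

open Filter Topology Asymptotics
open scoped ENNReal

noncomputable section

/-! ### Qubit registers -/

/-- Pure-state space of a register whose qubits are labelled by `Q`, i.e. `(ℂ²)^{⊗ Q}` written in
the computational basis `Q → Fin 2`, with its Euclidean norm. -/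
abbrev QState (Q : Type) [Fintype Q] : Type := EuclideanSpace ℂ (Q → Fin 2)

/-- Linear operators on the register, as matrices in the computational basis. -/
abbrev QOp (Q : Type) : Type := Matrix (Q → Fin 2) (Q → Fin 2) ℂ

/-- Spectral (operator) norm of an operator on a register. -/
def opNorm {Q : Type} [Fintype Q] [DecidableEq Q] (A : QOp Q) : ℝ :=
  ‖Matrix.toEuclideanCLM (𝕜 := ℂ) A‖

open Classical in
/-- `A` acts only on the qubits in `X`: it is `B ⊗ 1` with `B` an operator on the qubits in `X`
and `1` the identity on all the other qubits. -/
def ActsOn {Q : Type} (X : Finset Q) (A : QOp Q) : Prop :=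
  ∃ B : QOp X, ∀ x y : Q → Fin 2,
    A x y = if ∀ i, i ∉ X → x i = y i then B (fun i => x i) (fun i => y i) else 0

/-- `A ⊗ 1` on the joint register `Q ⊕ R`. -/
def tensorOne {Q R : Type} [Fintype R] [DecidableEq R] (A : QOp Q) : QOp (Q ⊕ R) :=
  fun x y => if (fun r => x (Sum.inr r)) = (fun r => y (Sum.inr r))
    then A (fun q => x (Sum.inl q)) (fun q => y (Sum.inl q)) else 0

/-- `|ψ⟩ ⊗ |0…0⟩` on the joint register `Q ⊕ R`. -/
def withZeros {Q R : Type} [Fintype Q] [Fintype R] (ψ : QState Q) : QState (Q ⊕ R) :=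
  WithLp.toLp 2 fun x => if ∀ r, x (Sum.inr r) = 0 then ψ (fun q => x (Sum.inl q)) else 0

/-! ### Hamiltonians -/

/-- The evolution operator `e^{-itH}`. -/
def evolution {Q : Type} [Fintype Q] [DecidableEq Q] (H : QOp Q) (t : ℝ) : QOp Q :=
  NormedSpace.exp ((-(Complex.I * (t : ℂ))) • H)

/-- The `n`-qubit Hamiltonians that are `k`-local and of degree at most `g` (`g = ⊤` is no
restriction on the degree): `H = ∑_X h_X`, the sum over sets `X` of qubits, each `h_X` Hermitian,
acting on `X`, of norm at most `1`, with at most `k` qubits in every `X` that occurs and every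
qubit in at most `g` of the sets that occur. -/
def LocalHamiltonians (k : ℕ) (g : ℕ∞) (n : ℕ) : Set (QOp (Fin n)) :=
  {H | ∃ h : Finset (Fin n) → QOp (Fin n),
    (∀ X, (h X).IsHermitian ∧ ActsOn X (h X) ∧ opNorm (h X) ≤ 1) ∧
    (∀ X, h X ≠ 0 → X.card ≤ k) ∧
    (∀ i, {X : Finset (Fin n) | i ∈ X ∧ h X ≠ 0}.encard ≤ g) ∧
    H = ∑ X, h X}

/-- `H` is invariant under all permutations of the qubits: `P_σ H P_σ⁻¹ = H`, where `P_σ` permutes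
the tensor factors. -/
def PermutationInvariant {n : ℕ} (H : QOp (Fin n)) : Prop :=
  ∀ (σ : Equiv.Perm (Fin n)) (x y : Fin n → Fin 2), H (x ∘ σ) (y ∘ σ) = H x y

/-! ### Circuits of two-qubit gates -/

/-- A two-qubit gate: a unitary acting on at most two qubits (`i = j` gives one-qubit gates). -/
def IsTwoQubitGate {Q : Type} [Fintype Q] [DecidableEq Q] (U : QOp Q) : Prop :=
  U ∈ Matrix.unitaryGroup (Q → Fin 2) ℂ ∧ ∃ i j : Q, ActsOn {i, j} U

/-- A quantum circuit on the register `Q`: a finite sequence of two-qubit gates. -/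
structure QCircuit (Q : Type) [Fintype Q] [DecidableEq Q] where
  gates : List (QOp Q)
  isGate : ∀ U ∈ gates, IsTwoQubitGate U

/-- The quantum complexity of a circuit: its number of gates. -/
def QCircuit.complexity {Q : Type} [Fintype Q] [DecidableEq Q] (V : QCircuit Q) : ℕ :=
  V.gates.length

/-- The unitary that a circuit implements (the last gate of the list is applied first). -/
def QCircuit.toOp {Q : Type} [Fintype Q] [DecidableEq Q] (V : QCircuit Q) : QOp Q :=
  V.gates.prod

/-! ### Simulation and fast-forwarding -/

/-- For one system size: the circuits `V t`, on `n` system qubits and `a` ancilla qubits, simulate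
`H` on the subspace `S` with parameters `(T, ε, G)`. -/
def SimulatesAt {n a : ℕ} (V : ℝ → QCircuit (Fin n ⊕ Fin a)) (H : QOp (Fin n))
    (S : Submodule ℂ (QState (Fin n))) (T ε : ℝ) (G : ℕ) : Prop :=
  ∀ t : ℝ, 0 ≤ t → t ≤ T → (V t).complexity ≤ G ∧
    ∀ ψ ∈ S, ‖ψ‖ = 1 →
      ‖Matrix.toEuclideanLin (tensorOne (evolution H t) - (V t).toOp) (withZeros ψ)‖ ≤ ε

/-- A family of circuits `V_n(t)`, together with the number of ancilla qubits used at each `n`. -/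
structure CircuitFamily where
  ancillas : ℕ → ℕ
  circuit : (n : ℕ) → ℝ → QCircuit (Fin n ⊕ Fin (ancillas n))

/-- The circuits `V_n(t)` simulate the sequence `H_n`, `n = 1, 2, …`, on the subspaces `S_n` with
parameters `(T(n), ε(n), G(n))`. -/
def Simulates (V : CircuitFamily) (H : (n : ℕ) → QOp (Fin n))
    (S : (n : ℕ) → Submodule ℂ (QState (Fin n))) (T ε : ℕ → ℝ) (G : ℕ → ℕ) : Prop :=
  ∀ n, 1 ≤ n → SimulatesAt (V.circuit n) (H n) (S n) (T n) (ε n) (G n)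

/-- The no-fast-forwarding line of the classes `C_n` for `T(n)` and `ε(n)`: the largest, over
`H ∈ C_n`, of the least gate count that suffices to simulate `H` for all times up to `T(n)`. -/
def noFastForwardingLine (C : (n : ℕ) → Set (QOp (Fin n))) (T ε : ℕ → ℝ) (n : ℕ) : ℕ∞ :=
  ⨆ H ∈ C n, ⨅ G ∈ {G : ℕ | ∃ (a : ℕ) (V : ℝ → QCircuit (Fin n ⊕ Fin a)),
    SimulatesAt V H ⊤ (T n) (ε n) G}, (G : ℕ∞)

/-- `l(n) = Ω(f(n))`. -/
def IsOmega (l : ℕ → ℕ∞) (f : ℕ → ℝ) : Prop :=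
  ∃ c : ℝ, 0 < c ∧ ∀ᶠ n in atTop, ENNReal.ofReal (c * f n) ≤ (l n : ℝ≥0∞)

/-- The circuits `V_n(t)` are `(T(n), ε(n), G(n))`-fast-forwarding the sequence `H_n ∈ C_n` on the
subspaces `S_n`: they simulate it, and `G(n) / l(n) → 0` for the line `l` of the classes `C_n`. -/
def FastForwards (C : (n : ℕ) → Set (QOp (Fin n))) (V : CircuitFamily)
    (H : (n : ℕ) → QOp (Fin n)) (S : (n : ℕ) → Submodule ℂ (QState (Fin n)))
    (T ε : ℕ → ℝ) (G : ℕ → ℕ) : Prop :=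
  Simulates V H S T ε G ∧
    Tendsto (fun n => (G n : ℝ≥0∞) / (noFastForwardingLine C T ε n : ℝ≥0∞)) atTop (𝓝 0)

/-- Exponential fast-forwarding: fast-forwarding with `G(n)` polynomially bounded while the line
`l(n)` is (at least) exponential in `n`. -/
def ExponentiallyFastForwards (C : (n : ℕ) → Set (QOp (Fin n))) (V : CircuitFamily)
    (H : (n : ℕ) → QOp (Fin n)) (S : (n : ℕ) → Submodule ℂ (QState (Fin n)))
    (T ε : ℕ → ℝ) (G : ℕ → ℕ) : Prop :=
  FastForwards C V H S T ε G ∧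
    (∃ p : ℕ, (fun n => (G n : ℝ)) =O[atTop] (fun n => (n : ℝ) ^ p)) ∧
    ∃ b : ℝ, 1 < b ∧ IsOmega (noFastForwardingLine C T ε) (fun n => b ^ n)

end

/-! By Schur–Weyl duality, a permutation-invariant operator on n qubits is in the Schur basis a
direct sum of small blocks, one for each Young diagram with at most two rows, each tensored with an
identity. The evolution is thus a block diagonal unitary with polynomially many parameters, whatever
t is. It can be synthesised without error, at a cost independent of t.

The duality is used in this form: H is a linear combination of tensor powers of 2×2 matrices
(`permutationInvariant_mem_span`); by Newton's identities each tensor power is a polynomial in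
collective operators (`tensorPower_mem_spinAlgebra`); and those are generated by the collective
lowering and raising operators. Only these two have to be brought to block form. An explicit Schur
transform does this, coupling the qubits one at a time by Clebsch-Gordan rotations
(`lowering_isCoupled`, `raising_isCoupled`, `IsCoupledBy.schur`).

For the circuits, the pair (number of ones, second-row length) is stored in unary: it is the
position of one particle on (n+2)² ancilla qubits. Mixing two positions is then a two-qubit gate,
and a unitary on s positions takes at most s² gates by Givens elimination
(`Implementable.ofUnitary`). Each of the n couplings takes O(n²) gates (`schur_implementable`), and
so does each of the n+2 blocks (`Implementable.blockDiagonal`). Transform, blocks and inverse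
transform together take O(n³) gates (`exists_circuit_evolution`), and the fast-forwarding claims
reduce to comparing n³ with the line. -/

open scoped Kronecker

/-! ### Permutation-invariant operators are generated by collective operators -/

/-- The product operator `⊗ᵢ f i`. -/
def productOp {n : ℕ} : (Fin n → Matrix (Fin 2) (Fin 2) ℂ) →* QOp (Fin n) where
  toFun f := Matrix.of fun x y => ∏ i, f i (x i) (y i)
  map_one' := by
    ext x y
    simp only [Matrix.of_apply, Pi.one_apply, Matrix.one_apply, Finset.prod_ite_zero,
      Finset.mem_univ, true_imp_iff, Finset.prod_const_one, funext_iff]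
  map_mul' f g := by
    ext x y
    simp only [Matrix.of_apply, Pi.mul_apply, Matrix.mul_apply, ← Finset.prod_mul_distrib]
    rw [Finset.prod_univ_sum]
    simp

theorem productOp_apply {n : ℕ} (f : Fin n → Matrix (Fin 2) (Fin 2) ℂ) (x y : Fin n → Fin 2) :
    productOp f x y = ∏ i, f i (x i) (y i) := rfl

/-- The one-qubit operator `B` acting on qubit `i`. -/
def siteOp {n : ℕ} (i : Fin n) (B : Matrix (Fin 2) (Fin 2) ℂ) : QOp (Fin n) :=
  productOp (Pi.mulSingle i B)

theorem siteOp_apply {n : ℕ} (i : Fin n) (B : Matrix (Fin 2) (Fin 2) ℂ) (x y : Fin n → Fin 2) :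
    siteOp i B x y = if ∀ j, j ≠ i → x j = y j then B (x i) (y i) else 0 := by
  have : ∀ j ∈ Finset.univ.erase i, (Pi.mulSingle i B : Fin n → Matrix (Fin 2) (Fin 2) ℂ) j (x j)
      (y j) = if x j = y j then 1 else 0 := by
    intro j hj
    rw [Pi.mulSingle_eq_of_ne (Finset.ne_of_mem_erase hj), Matrix.one_apply]
  rw [siteOp, productOp_apply, ← Finset.mul_prod_erase _ _ (Finset.mem_univ i),
    Finset.prod_congr rfl this, Finset.prod_ite_zero]
  simp

theorem siteOp_mul {n : ℕ} (i : Fin n) (A B : Matrix (Fin 2) (Fin 2) ℂ) :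
    siteOp i A * siteOp i B = siteOp i (A * B) := by
  rw [siteOp, siteOp, siteOp, ← map_mul, ← Pi.mulSingle_mul]

theorem siteOp_pow {n : ℕ} (i : Fin n) (A : Matrix (Fin 2) (Fin 2) ℂ) (m : ℕ) :
    siteOp i A ^ m = siteOp i (A ^ m) := by
  rw [siteOp, siteOp, ← map_pow, ← Pi.mulSingle_pow]

theorem siteOp_commute {n : ℕ} {i j : Fin n} (hij : i ≠ j) (A B : Matrix (Fin 2) (Fin 2) ℂ) :
    siteOp i A * siteOp j B = siteOp j B * siteOp i A := by
  rw [siteOp, siteOp, ← map_mul, ← map_mul]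
  exact congrArg productOp (Pi.mulSingle_commute (f := fun _ => Matrix (Fin 2) (Fin 2) ℂ) hij A B).eq

/-- The collective operator `∑ᵢ Bᵢ`. -/
def collective {n : ℕ} : Matrix (Fin 2) (Fin 2) ℂ →ₗ[ℂ] QOp (Fin n) where
  toFun B := ∑ i, siteOp i B
  map_add' A B := by
    rw [← Finset.sum_add_distrib]
    refine Finset.sum_congr rfl fun i _ => ?_
    ext x y
    simp only [siteOp_apply, Matrix.add_apply]
    split_ifs <;> simp
  map_smul' c B := by
    rw [RingHom.id_apply, Finset.smul_sum]
    refine Finset.sum_congr rfl fun i _ => ?_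
    ext x y
    simp only [siteOp_apply, Matrix.smul_apply]
    split_ifs <;> simp

theorem collective_apply {n : ℕ} (B : Matrix (Fin 2) (Fin 2) ℂ) :
    (collective B : QOp (Fin n)) = ∑ i, siteOp i B := rfl

theorem collective_one {n : ℕ} : (collective 1 : QOp (Fin n)) = (n : ℂ) • 1 := by
  simp only [collective_apply, siteOp, Pi.mulSingle_one, map_one, Finset.sum_const,
    Finset.card_univ, Fintype.card_fin, Nat.cast_smul_eq_nsmul]

/-- Operators at different qubits commute, so only the diagonal terms of the double sum survive. -/
theorem collective_commutator {n : ℕ} (A B : Matrix (Fin 2) (Fin 2) ℂ) :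
    (collective A * collective B - collective B * collective A : QOp (Fin n)) =
      collective (A * B - B * A) := by
  rw [map_sub]
  simp only [collective_apply, Finset.sum_mul_sum]
  rw [Finset.sum_comm (f := fun i j => siteOp i B * siteOp j A), ← Finset.sum_sub_distrib,
    ← Finset.sum_sub_distrib]
  refine Finset.sum_congr rfl fun i _ => ?_
  rw [← Finset.sum_sub_distrib, Finset.sum_eq_single i]
  · rw [siteOp_mul, siteOp_mul]
  · intro j _ hj
    rw [siteOp_commute (Ne.symm hj), sub_self]
  · simp

/-- The algebra generated by the collective lowering and raising operators. -/
def spinAlgebra (n : ℕ) : Subalgebra ℂ (QOp (Fin n)) :=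
  Algebra.adjoin ℂ {collective (Matrix.single 0 1 1), collective (Matrix.single 1 0 1)}

/-- The commutator of the two generators is the collective Pauli Z, and the collective identity is a
scalar; with the generators these span the image of all 2×2 matrices. -/
theorem collective_mem_spinAlgebra {n : ℕ} (B : Matrix (Fin 2) (Fin 2) ℂ) :
    collective B ∈ spinAlgebra n := by
  have h01 : collective (Matrix.single 0 1 1) ∈ spinAlgebra n :=
    Algebra.subset_adjoin (by simp)
  have h10 : collective (Matrix.single 1 0 1) ∈ spinAlgebra n :=
    Algebra.subset_adjoin (by simp)
  have h1 : collective 1 ∈ spinAlgebra n := by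
    rw [collective_one]
    exact Subalgebra.smul_mem _ (one_mem _) _
  have hz := sub_mem (mul_mem h01 h10) (mul_mem h10 h01)
  rw [collective_commutator] at hz
  have hB : B = B 0 1 • Matrix.single 0 1 1 + B 1 0 • Matrix.single 1 0 1 +
      ((B 0 0 + B 1 1) / 2) • (1 : Matrix (Fin 2) (Fin 2) ℂ) +
      ((B 0 0 - B 1 1) / 2) • ((Matrix.single 0 1 1 : Matrix (Fin 2) (Fin 2) ℂ) *
        Matrix.single 1 0 1 - Matrix.single 1 0 1 * Matrix.single 0 1 1) := by
    ext i j
    fin_cases i <;> fin_cases j <;> simp <;> ring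
  rw [hB]
  simp only [map_add, map_smul]
  exact add_mem (add_mem (add_mem (Subalgebra.smul_mem _ h01 _) (Subalgebra.smul_mem _ h10 _))
    (Subalgebra.smul_mem _ h1 _)) (Subalgebra.smul_mem _ hz _)

/-- Newton's identities express `k * esymm k` through power sums and lower `esymm`; in
characteristic zero one may divide by `k`. -/
theorem esymm_mem_adjoin_psum (σ : Type*) [Fintype σ] (k : ℕ) :
    MvPolynomial.esymm σ ℂ k ∈ Algebra.adjoin ℂ (Set.range (MvPolynomial.psum σ ℂ)) := by
  induction k using Nat.strong_induction_on with
  | _ k ih =>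
    rcases Nat.eq_zero_or_pos k with rfl | hk
    · rw [MvPolynomial.esymm_zero]
      exact one_mem _
    have h : MvPolynomial.esymm σ ℂ k = (k : ℂ)⁻¹ • ((k : MvPolynomial σ ℂ) *
        MvPolynomial.esymm σ ℂ k) := by
      rw [← nsmul_eq_mul, ← Nat.cast_smul_eq_nsmul ℂ, smul_smul, inv_mul_cancel₀, one_smul]
      exact_mod_cast hk.ne'
    rw [h, MvPolynomial.mul_esymm_eq_sum]
    have hneg : ∀ j : ℕ, (-1 : MvPolynomial σ ℂ) ^ j ∈
        Algebra.adjoin ℂ (Set.range (MvPolynomial.psum σ ℂ)) :=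
      fun j => pow_mem (neg_mem (one_mem _)) j
    refine Subalgebra.smul_mem _ (mul_mem (hneg _) (sum_mem fun a ha => ?_)) _
    exact mul_mem (mul_mem (hneg _) (ih _ (Finset.mem_filter.1 ha).2))
      (Algebra.subset_adjoin ⟨_, rfl⟩)

/-- The tensor power is the top elementary symmetric polynomial evaluated at the commuting copies of
`A`. The power sums of these copies are the collective operators of the powers of `A`. -/
theorem tensorPower_mem_spinAlgebra {n : ℕ} (A : Matrix (Fin 2) (Fin 2) ℂ) :
    productOp (fun _ => A) ∈ spinAlgebra n := by
  have hcomm : ∀ a ∈ Set.range (fun i : Fin n => siteOp i A),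
      ∀ b ∈ Set.range (fun i : Fin n => siteOp i A), a * b = b * a := by
    rintro _ ⟨i, rfl⟩ _ ⟨j, rfl⟩
    rcases eq_or_ne i j with rfl | hij
    · rfl
    · exact siteOp_commute hij A A
  let S := Algebra.adjoin ℂ (Set.range (fun i : Fin n => siteOp i A))
  -- Evaluating polynomials needs a commutative target, hence the passage to the subalgebra
  -- generated by the commuting copies.
  let _ : CommRing S := { (inferInstance : Ring S) with
    mul_comm := fun a b => (Algebra.isMulCommutative_adjoin ℂ hcomm).is_comm.comm a b }
  let a : Fin n → S := fun i => ⟨siteOp i A, Algebra.subset_adjoin ⟨i, rfl⟩⟩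
  let φ : MvPolynomial (Fin n) ℂ →ₐ[ℂ] S := MvPolynomial.aeval a
  have hprod : ∀ s : Finset (Fin n), ((∏ i ∈ s, a i : S) : QOp (Fin n)) =
      productOp (fun i => if i ∈ s then A else 1) := by
    intro s
    induction s using Finset.induction_on with
    | empty =>
      simp only [Finset.prod_empty, Finset.notMem_empty, if_false]
      exact (map_one (productOp (n := n))).symm
    | insert j s hj ih =>
      rw [Finset.prod_insert hj, Subalgebra.coe_mul, ih]
      change siteOp j A * _ = _
      rw [siteOp, ← map_mul]
      congr 1
      ext1 i
      rcases eq_or_ne i j with rfl | hij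
      · simp [hj]
      · simp [hij]
  have hpsum : ∀ m, ((φ (MvPolynomial.psum (Fin n) ℂ m) : S) : QOp (Fin n)) ∈ spinAlgebra n := by
    intro m
    have : ((φ (MvPolynomial.psum (Fin n) ℂ m) : S) : QOp (Fin n)) = collective (A ^ m) := by
      simp only [φ, MvPolynomial.psum, map_sum, map_pow, MvPolynomial.aeval_X,
        AddSubmonoidClass.coe_finsetSum, SubmonoidClass.coe_pow, a, siteOp_pow, collective_apply]
    rw [this]
    exact collective_mem_spinAlgebra _
  have hadj : Algebra.adjoin ℂ (Set.range (MvPolynomial.psum (Fin n) ℂ)) ≤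
      (spinAlgebra n).comap (S.val.comp φ) := by
    refine Algebra.adjoin_le ?_
    rintro _ ⟨m, rfl⟩
    exact hpsum m
  have h := hadj (esymm_mem_adjoin_psum (Fin n) n)
  have hval : (S.val.comp φ) (MvPolynomial.esymm (Fin n) ℂ n) = productOp (fun _ => A) := by
    have hesymm : MvPolynomial.esymm (Fin n) ℂ n = ∏ i, MvPolynomial.X i := by
      have := Finset.powersetCard_self (Finset.univ : Finset (Fin n))
      rw [Finset.card_univ, Fintype.card_fin] at this
      rw [MvPolynomial.esymm, this, Finset.sum_singleton]
    have := hprod Finset.univ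
    simp only [Finset.mem_univ, if_true] at this
    rw [← this, hesymm, AlgHom.comp_apply, map_prod]
    simp [φ]
  rw [← hval]
  exact h

/-- By duality, it suffices that every functional vanishing on all tensor powers vanishes on `H`. On
a tensor power such a functional is a polynomial in the entries of `A`; its coefficients are the
sums of the functional over orbits of matrix units, and `H` is constant on these orbits. -/
theorem permutationInvariant_mem_span {n : ℕ} {H : QOp (Fin n)} (hH : PermutationInvariant H) :
    H ∈ Submodule.span ℂ (Set.range fun A : Matrix (Fin 2) (Fin 2) ℂ =>
      (productOp (fun _ => A) : QOp (Fin n))) := by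
  by_contra hmem
  obtain ⟨φ, hφ, hker⟩ := Submodule.exists_le_ker_of_notMem hmem
  have hφM : ∀ M : QOp (Fin n), φ M = ∑ z : (Fin n → Fin 2) × (Fin n → Fin 2),
      M z.1 z.2 * φ (Matrix.single z.1 z.2 1) := by
    intro M
    conv_lhs => rw [Matrix.matrix_eq_sum_single M]
    rw [map_sum, Fintype.sum_prod_type]
    refine Finset.sum_congr rfl fun x _ => ?_
    rw [map_sum]
    refine Finset.sum_congr rfl fun y _ => ?_
    rw [← smul_eq_mul, ← map_smul, Matrix.smul_single, smul_eq_mul, mul_one]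
  -- The type counts how often each pair of bits occurs in a matrix unit. It is the exponent of the
  -- corresponding monomial and a complete invariant of the orbit.
  let type : (Fin n → Fin 2) × (Fin n → Fin 2) → (Fin 2 × Fin 2 →₀ ℕ) :=
    fun z => ∑ i, Finsupp.single (z.1 i, z.2 i) 1
  let P : MvPolynomial (Fin 2 × Fin 2) ℂ :=
    ∑ z, MvPolynomial.monomial (type z) (φ (Matrix.single z.1 z.2 1))
  -- A polynomial over an infinite field that vanishes at every point is zero.
  have hP : P = 0 := by
    refine MvPolynomial.funext fun a => ?_
    have hA : φ (productOp fun _ => Matrix.of fun i j => a (i, j)) = 0 :=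
      hker (Submodule.subset_span ⟨Matrix.of fun i j => a (i, j), rfl⟩)
    rw [hφM] at hA
    rw [map_zero, ← hA, map_sum]
    refine Finset.sum_congr rfl fun z _ => ?_
    rw [MvPolynomial.eval_monomial, mul_comm, productOp_apply]
    congr 1
    simp only [type]
    rw [← Finsupp.prod_finsetSum_index (fun _ => pow_zero _) (fun _ _ _ => pow_add _ _ _)]
    refine Finset.prod_congr rfl fun i _ => ?_
    exact (Finsupp.prod_single_index (h := fun c e => a c ^ e) (pow_zero _)).trans (pow_one _)
  have htype : ∀ z z', type z = type z' → H z.1 z.2 = H z'.1 z'.2 := by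
    intro z z' h
    have hcard : ∀ c : Fin 2 × Fin 2, Fintype.card {i // (z.1 i, z.2 i) = c} =
        Fintype.card {i // (z'.1 i, z'.2 i) = c} := by
      have key : ∀ (z : (Fin n → Fin 2) × (Fin n → Fin 2)) (c : Fin 2 × Fin 2),
          type z c = Fintype.card {i // (z.1 i, z.2 i) = c} := by
        intro z c
        simp only [type, Finsupp.finsetSum_apply, Finsupp.single_apply]
        rw [Fintype.card_subtype, Finset.card_filter]
      intro c
      rw [← key, ← key, h]
    let e : ∀ c : Fin 2 × Fin 2, {i // (z.1 i, z.2 i) = c} ≃ {i // (z'.1 i, z'.2 i) = c} :=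
      fun c => Fintype.equivOfCardEq (hcard c)
    -- Equal types give equally many positions for each pair of bits; matching these positions
    -- yields the permutation.
    let σ : Equiv.Perm (Fin n) := Equiv.ofFiberEquiv e
    have hσ : ∀ i, (z'.1 (σ i), z'.2 (σ i)) = (z.1 i, z.2 i) := fun i => Equiv.ofFiberEquiv_map e i
    rw [← hH σ z'.1 z'.2]
    congr 1
    · ext1 i
      exact (congrArg Prod.fst (hσ i)).symm
    · ext1 i
      exact (congrArg Prod.snd (hσ i)).symm
  refine hφ ?_
  rw [hφM, ← Finset.sum_fiberwise_of_maps_to (s := Finset.univ) (t := Finset.univ.image type)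
    (g := type) (fun z _ => Finset.mem_image_of_mem _ (Finset.mem_univ z))]
  refine Finset.sum_eq_zero fun c hc => ?_
  obtain ⟨z₀, -, rfl⟩ := Finset.mem_image.1 hc
  have hcoeff : ∑ z with type z = type z₀, φ (Matrix.single z.1 z.2 1) = 0 := by
    have := congrArg (MvPolynomial.coeff (type z₀)) hP
    simpa only [P, MvPolynomial.coeff_sum, MvPolynomial.coeff_monomial, MvPolynomial.coeff_zero,
      ← Finset.sum_filter] using this
  rw [← mul_zero (H z₀.1 z₀.2), ← hcoeff, Finset.mul_sum]
  refine Finset.sum_congr rfl fun z hz => ?_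
  rw [htype z z₀ (Finset.mem_filter.1 hz).2]

theorem permutationInvariant_mem_spinAlgebra {n : ℕ} {H : QOp (Fin n)}
    (hH : PermutationInvariant H) : H ∈ spinAlgebra n := by
  have hle : Submodule.span ℂ (Set.range fun A : Matrix (Fin 2) (Fin 2) ℂ =>
      (productOp (fun _ => A) : QOp (Fin n))) ≤ Subalgebra.toSubmodule (spinAlgebra n) := by
    rw [Submodule.span_le]
    rintro _ ⟨A, rfl⟩
    exact tensorPower_mem_spinAlgebra A
  exact hle (permutationInvariant_mem_span hH)

/-! ### Basis vectors and matrices acting on one tensor factor -/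

/-- The basis vector `|l⟩`. -/
abbrev ket {L : Type*} [DecidableEq L] (l : L) : L → ℂ := Pi.single l 1

theorem ket_apply {L : Type*} [DecidableEq L] (l k : L) : ket l k = if k = l then 1 else 0 :=
  Pi.single_apply _ _ _

theorem Matrix.ext_of_mulVec_ket {K L : Type*} [Fintype L] [DecidableEq L] {A B : Matrix K L ℂ}
    (h : ∀ l, A.mulVec (ket l) = B.mulVec (ket l)) : A = B := by
  ext k l
  simpa using congrFun (h l) k

theorem mulVec_ket_apply {K L : Type*} [Fintype L] [DecidableEq L] (A : Matrix K L ℂ) (l : L)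
    (k : K) : A.mulVec (ket l) k = A k l := by
  simp

theorem mulVec_ket_eq_sum {K L : Type*} [Fintype K] [DecidableEq K] [Fintype L] [DecidableEq L]
    (A : Matrix K L ℂ) (l : L) : A.mulVec (ket l) = ∑ k, A k l • ket k := by
  ext k
  simp [Pi.single_apply]

theorem one_kronecker_mulVec_ket {X Y : Type*} [Fintype X] [DecidableEq X] [Fintype Y]
    [DecidableEq Y] (A : Matrix Y Y ℂ) (x : X) (y : Y) :
    ((1 : Matrix X X ℂ) ⊗ₖ A).mulVec (ket (x, y)) = ∑ z, A z y • ket (x, z) := by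
  rw [mulVec_ket_eq_sum, Fintype.sum_prod_type, Finset.sum_eq_single x]
  · simp
  · intro b _ hb
    simp [Matrix.one_apply_ne hb]
  · simp

theorem kronecker_one_mulVec_ket {X Y : Type*} [Fintype X] [DecidableEq X] [Fintype Y]
    [DecidableEq Y] (A : Matrix X X ℂ) (x : X) (y : Y) :
    (A ⊗ₖ (1 : Matrix Y Y ℂ)).mulVec (ket (x, y)) = ∑ z, A z x • ket (z, y) := by
  rw [mulVec_ket_eq_sum, Fintype.sum_prod_type]
  refine Finset.sum_congr rfl fun z _ => ?_
  rw [Finset.sum_eq_single y]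
  · simp
  · intro b _ hb
    simp [Matrix.one_apply_ne hb]
  · simp

/-- The block index is the second component: the site in `Fin 2 × Y`, the length of the second row
in `YoungSite`. -/
theorem sum_blockDiagonal_smul {X Y M : Type*} [Fintype X] [Fintype Y] [DecidableEq Y]
    [AddCommMonoid M] [Module ℂ M] (A : Y → Matrix X X ℂ) (x : X) (y : Y) (F : X × Y → M) :
    ∑ c, Matrix.blockDiagonal A c (x, y) • F c = ∑ z, A y z x • F (z, y) := by
  rw [Fintype.sum_prod_type]
  refine Finset.sum_congr rfl fun z _ => ?_
  rw [Finset.sum_eq_single y]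
  · rw [Matrix.blockDiagonal_apply_eq]
  · intro b _ hb
    rw [Matrix.blockDiagonal_apply_ne _ _ _ hb, zero_smul]
  · simp

theorem blockDiagonal_mem_unitary {X Y : Type*} [Fintype X] [DecidableEq X] [Fintype Y]
    [DecidableEq Y] {A : Y → Matrix X X ℂ} (hA : ∀ y, A y ∈ Matrix.unitaryGroup X ℂ) :
    Matrix.blockDiagonal A ∈ Matrix.unitaryGroup (X × Y) ℂ := by
  rw [Matrix.mem_unitaryGroup_iff, Matrix.star_eq_conjTranspose, Matrix.blockDiagonal_conjTranspose,
    ← Matrix.blockDiagonal_mul, ← Matrix.blockDiagonal_one]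
  congr 1
  ext1 y
  exact Matrix.mem_unitaryGroup_iff.1 (hA y)

theorem submatrix_equiv_mem_unitary {X Y : Type*} [Fintype X] [DecidableEq X] [Fintype Y]
    [DecidableEq Y] (e : X ≃ Y) {A : Matrix Y Y ℂ} (hA : A ∈ Matrix.unitaryGroup Y ℂ) :
    A.submatrix e e ∈ Matrix.unitaryGroup X ℂ := by
  rw [Matrix.mem_unitaryGroup_iff, Matrix.star_eq_conjTranspose, Matrix.conjTranspose_submatrix,
    Matrix.submatrix_mul_equiv, ← Matrix.star_eq_conjTranspose, Matrix.mem_unitaryGroup_iff.1 hA,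
    Matrix.submatrix_one_equiv]

theorem one_kronecker_mul {X Y : Type*} [Fintype X] [DecidableEq X] [Fintype Y]
    (A B : Matrix Y Y ℂ) :
    (1 : Matrix X X ℂ) ⊗ₖ (A * B) = ((1 : Matrix X X ℂ) ⊗ₖ A) * ((1 : Matrix X X ℂ) ⊗ₖ B) := by
  rw [← Matrix.mul_kronecker_mul, one_mul]

theorem one_kronecker_conjTranspose {X Y : Type*} [DecidableEq X] (A : Matrix Y Y ℂ) :
    ((1 : Matrix X X ℂ) ⊗ₖ A).conjTranspose = (1 : Matrix X X ℂ) ⊗ₖ A.conjTranspose := by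
  rw [Matrix.conjTranspose_kronecker, Matrix.conjTranspose_one]

/-! ### Two-level operators -/

/-- The inclusion of the span of `|y⟩, |y'⟩`. -/
def pairInclusion {Y : Type*} [DecidableEq Y] (y y' : Y) : Matrix Y (Fin 2) ℂ :=
  Matrix.of fun z a => if z = if a = 0 then y else y' then 1 else 0

/-- The operator `u` on the span of `|y⟩, |y'⟩`, extended by the identity. -/
def twoLevel {Y : Type*} [DecidableEq Y] (y y' : Y) (u : Matrix (Fin 2) (Fin 2) ℂ) :
    Matrix Y Y ℂ :=
  1 + pairInclusion y y' * (u - 1) * (pairInclusion y y').conjTranspose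

theorem pairInclusion_isometry {Y : Type*} [Fintype Y] [DecidableEq Y] {y y' : Y} (h : y ≠ y') :
    (pairInclusion y y').conjTranspose * pairInclusion y y' = 1 := by
  ext a b
  fin_cases a <;> fin_cases b <;>
    simp [pairInclusion, Matrix.mul_apply, Matrix.conjTranspose_apply, h, h.symm]

theorem twoLevel_mul {Y : Type*} [Fintype Y] [DecidableEq Y] {y y' : Y} (h : y ≠ y')
    (u v : Matrix (Fin 2) (Fin 2) ℂ) :
    twoLevel y y' u * twoLevel y y' v = twoLevel y y' (u * v) := by
  have hp := pairInclusion_isometry h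
  simp only [twoLevel]
  generalize (pairInclusion y y').conjTranspose = G at *
  generalize pairInclusion y y' = F at *
  have h1 : F * (u - 1) * G * (F * (v - 1) * G) = F * ((u - 1) * (v - 1)) * G := by
    calc F * (u - 1) * G * (F * (v - 1) * G) = F * (u - 1) * (G * F) * (v - 1) * G := by
          simp only [Matrix.mul_assoc]
      _ = _ := by rw [hp]; simp only [Matrix.mul_assoc, Matrix.one_mul]
  rw [add_mul, mul_add, mul_add, h1, one_mul, one_mul, mul_one]
  have h2 : u * v - 1 = (v - 1) + (u - 1) + (u - 1) * (v - 1) := by noncomm_ring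
  rw [h2]
  simp only [Matrix.mul_add, Matrix.add_mul]
  abel

theorem twoLevel_one {Y : Type*} [DecidableEq Y] (y y' : Y) : twoLevel y y' 1 = 1 := by
  rw [twoLevel, sub_self, Matrix.mul_zero, Matrix.zero_mul, add_zero]

theorem twoLevel_conjTranspose {Y : Type*} [DecidableEq Y] (y y' : Y)
    (u : Matrix (Fin 2) (Fin 2) ℂ) :
    (twoLevel y y' u).conjTranspose = twoLevel y y' u.conjTranspose := by
  simp only [twoLevel, Matrix.conjTranspose_add, Matrix.conjTranspose_mul,
    Matrix.conjTranspose_sub, Matrix.conjTranspose_one, Matrix.conjTranspose_conjTranspose,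
    Matrix.mul_assoc]

theorem twoLevel_mem_unitary {Y : Type*} [Fintype Y] [DecidableEq Y] {y y' : Y} (h : y ≠ y')
    {u : Matrix (Fin 2) (Fin 2) ℂ} (hu : u ∈ Matrix.unitaryGroup (Fin 2) ℂ) :
    twoLevel y y' u ∈ Matrix.unitaryGroup Y ℂ := by
  rw [Matrix.mem_unitaryGroup_iff, Matrix.star_eq_conjTranspose, twoLevel_conjTranspose,
    twoLevel_mul h, ← Matrix.star_eq_conjTranspose, Matrix.mem_unitaryGroup_iff.1 hu, twoLevel_one]

theorem twoLevel_apply {Y : Type*} [DecidableEq Y] (y y' : Y) (u : Matrix (Fin 2) (Fin 2) ℂ)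
    (z w : Y) : twoLevel y y' u z w = (if z = w then 1 else 0) +
      ((if z = y then u 0 0 - 1 else 0) + (if z = y' then u 1 0 else 0)) *
        (if w = y then 1 else 0) +
      ((if z = y then u 0 1 else 0) + (if z = y' then u 1 1 - 1 else 0)) *
        (if w = y' then 1 else 0) := by
  simp [twoLevel, pairInclusion, Matrix.mul_apply, Matrix.conjTranspose_apply, Fin.sum_univ_two,
    Matrix.one_apply]
  ring

/-- Stated for module-valued `F`, so that it serves both for the sites and for the pair of ancilla
qubits that encodes two of them. -/
theorem sum_twoLevel_smul {Y M : Type*} [Fintype Y] [DecidableEq Y] [AddCommGroup M] [Module ℂ M]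
    (y y' : Y) (u : Matrix (Fin 2) (Fin 2) ℂ) (w : Y) (F : Y → M) :
    ∑ z, twoLevel y y' u z w • F z = F w +
      (if w = y then (u 0 0 - 1) • F y + u 1 0 • F y' else 0) +
      (if w = y' then u 0 1 • F y + (u 1 1 - 1) • F y' else 0) := by
  simp only [twoLevel_apply, add_smul, Finset.sum_add_distrib, mul_ite, mul_one, mul_zero,
    ite_smul, zero_smul, one_smul, Finset.sum_ite_eq', Finset.mem_univ, if_true]
  congr 1
  · congr 1
    split_ifs <;> simp [Finset.sum_add_distrib]
  · split_ifs <;> simp [Finset.sum_add_distrib]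

/-! ### Two-qubit gates -/

/-- The configurations of a register split into those of the qubits `i`, `j` and of the rest. -/
def pairSplit {Q : Type} [DecidableEq Q] {i j : Q} (hij : i ≠ j) :
    (Q → Fin 2) ≃ ({l // l ≠ i ∧ l ≠ j} → Fin 2) × (Fin 2 × Fin 2) where
  toFun q := (fun l => q l, (q i, q j))
  invFun p l := if hi : l = i then p.2.1 else if hj : l = j then p.2.2 else p.1 ⟨l, hi, hj⟩
  left_inv q := by
    ext1 l
    dsimp only
    split_ifs with hi hj
    · rw [hi]
    · rw [hj]
    · rfl
  right_inv p := by
    refine Prod.ext ?_ (Prod.ext ?_ ?_)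
    · ext1 l
      simp [l.2.1, l.2.2]
    · simp
    · simp [hij.symm]

/-- The operator `B` on the qubits `i`, `j`, extended by the identity. -/
def pairGate {Q : Type} [Fintype Q] [DecidableEq Q] (i j : Q)
    (B : Matrix (Fin 2 × Fin 2) (Fin 2 × Fin 2) ℂ) : QOp Q :=
  Matrix.of fun p q => if ∀ l, l ≠ i ∧ l ≠ j → p l = q l then B (p i, p j) (q i, q j) else 0

/-- Exhibits the gate as an identity tensored with `B`, from which unitarity is inherited. -/
theorem pairGate_eq_submatrix {Q : Type} [Fintype Q] [DecidableEq Q] {i j : Q} (hij : i ≠ j)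
    (B : Matrix (Fin 2 × Fin 2) (Fin 2 × Fin 2) ℂ) :
    pairGate i j B = ((1 : Matrix ({l // l ≠ i ∧ l ≠ j} → Fin 2) _ ℂ) ⊗ₖ B).submatrix
      (pairSplit hij) (pairSplit hij) := by
  ext p q
  simp [pairGate, pairSplit, Matrix.one_apply, funext_iff]

theorem pairGate_isTwoQubitGate {Q : Type} [Fintype Q] [DecidableEq Q] {i j : Q} (hij : i ≠ j)
    {B : Matrix (Fin 2 × Fin 2) (Fin 2 × Fin 2) ℂ}
    (hB : B ∈ Matrix.unitaryGroup (Fin 2 × Fin 2) ℂ) : IsTwoQubitGate (pairGate i j B) := by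
  refine ⟨?_, i, j, fun x y => B (x ⟨i, by simp⟩, x ⟨j, by simp⟩) (y ⟨i, by simp⟩, y ⟨j, by simp⟩),
    fun x y => ?_⟩
  · rw [pairGate_eq_submatrix hij]
    exact submatrix_equiv_mem_unitary _ (Matrix.kronecker_mem_unitary (one_mem _) hB)
  · simp [pairGate]

theorem pairGate_mulVec_ket {Q : Type} [Fintype Q] [DecidableEq Q] {i j : Q} (hij : i ≠ j)
    (B : Matrix (Fin 2 × Fin 2) (Fin 2 × Fin 2) ℂ) (q : Q → Fin 2) :
    (pairGate i j B).mulVec (ket q) = ∑ c, B c (q i, q j) •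
      ket (Function.update (Function.update q i c.1) j c.2) := by
  ext p
  have hp : ∀ c : Fin 2 × Fin 2, p = Function.update (Function.update q i c.1) j c.2 ↔
      c = (p i, p j) ∧ ∀ l, l ≠ i ∧ l ≠ j → p l = q l := by
    intro c
    constructor
    · rintro rfl
      refine ⟨by ext <;> simp [hij], fun l hl => by simp [hl.1, hl.2]⟩
    · rintro ⟨rfl, h⟩
      ext1 l
      rcases eq_or_ne l j with rfl | hj
      · simp
      · rcases eq_or_ne l i with rfl | hi
        · simp [hij]
        · simp [hi, hj, h l ⟨hi, hj⟩]
  simp only [mulVec_ket_apply, Finset.sum_apply, Pi.smul_apply, Pi.single_apply, hp, smul_eq_mul,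
    mul_ite, mul_one, mul_zero, ite_and, Finset.sum_ite_eq', Finset.mem_univ, if_true]
  rfl

/-! ### One-hot encoding of a particle next to the qubits -/

/-- The basis state of the register that has the qubits in state `x` and, in the ancilla register,
a single excitation at the ancilla of the site `y`. -/
def encode {n a : ℕ} {Y : Type} (f : Y → Fin a) (l : (Fin n → Fin 2) × Y) : Fin n ⊕ Fin a → Fin 2 :=
  Sum.elim l.1 (Pi.single (f l.2) 1)

/-- The linear extension of `encode`. -/
def encodeMatrix (n : ℕ) {a : ℕ} {Y : Type} (f : Y → Fin a) :
    Matrix (Fin n ⊕ Fin a → Fin 2) ((Fin n → Fin 2) × Y) ℂ :=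
  Matrix.of fun q l => if q = encode f l then 1 else 0

/-- The operator `M` on the encoded space is implemented by a circuit of at most `G` gates. -/
def Implementable {n a : ℕ} {Y : Type} [Fintype Y] (f : Y → Fin a)
    (M : Matrix ((Fin n → Fin 2) × Y) ((Fin n → Fin 2) × Y) ℂ) (G : ℕ) : Prop :=
  ∃ V : QCircuit (Fin n ⊕ Fin a), V.complexity ≤ G ∧
    V.toOp * encodeMatrix n f = encodeMatrix n f * M

/-- The operator `A` on qubit `k` and the site of the particle. -/
def atQubit {n : ℕ} {Y : Type} (k : Fin n) (A : Matrix (Fin 2 × Y) (Fin 2 × Y) ℂ) :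
    Matrix ((Fin n → Fin 2) × Y) ((Fin n → Fin 2) × Y) ℂ :=
  Matrix.of fun l l' =>
    if ∀ j, j ≠ k → l.1 j = l'.1 j then A (l.1 k, l.2) (l'.1 k, l'.2) else 0

@[simp]
theorem encode_inl {n a : ℕ} {Y : Type} (f : Y → Fin a) (x : Fin n → Fin 2) (y : Y) (j : Fin n) :
    encode f (x, y) (Sum.inl j) = x j := rfl

@[simp]
theorem encode_inr {n a : ℕ} {Y : Type} (f : Y → Fin a) (x : Fin n → Fin 2) (y : Y) (q : Fin a) :
    encode f (x, y) (Sum.inr q) = if q = f y then 1 else 0 :=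
  Pi.single_apply _ _ _

theorem Implementable.mono {n a : ℕ} {Y : Type} [Fintype Y] {f : Y → Fin a}
    {M : Matrix ((Fin n → Fin 2) × Y) ((Fin n → Fin 2) × Y) ℂ} {G G' : ℕ}
    (h : Implementable f M G) (hG : G ≤ G') : Implementable f M G' :=
  let ⟨V, hV, hM⟩ := h
  ⟨V, hV.trans hG, hM⟩

section Implementable

variable {n a : ℕ} {Y : Type} [Fintype Y] [DecidableEq Y] {f : Y → Fin a}

theorem encodeMatrix_mulVec_ket (l : (Fin n → Fin 2) × Y) :
    (encodeMatrix n f).mulVec (ket l) = ket (encode f l) := by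
  ext q
  exact (mulVec_ket_apply _ _ _).trans (Pi.single_apply _ _ _).symm

/-! ### Composition and inversion of circuits -/

theorem QCircuit.toOp_mem_unitary {Q : Type} [Fintype Q] [DecidableEq Q] (V : QCircuit Q) :
    V.toOp ∈ Matrix.unitaryGroup (Q → Fin 2) ℂ :=
  Submonoid.list_prod_mem _ fun U hU => (V.isGate U hU).1

/-- The circuit of two circuits in a row. -/
def QCircuit.append {Q : Type} [Fintype Q] [DecidableEq Q] (V W : QCircuit Q) : QCircuit Q where
  gates := V.gates ++ W.gates
  isGate U hU := (List.mem_append.1 hU).elim (V.isGate U) (W.isGate U)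

theorem QCircuit.toOp_append {Q : Type} [Fintype Q] [DecidableEq Q] (V W : QCircuit Q) :
    (V.append W).toOp = V.toOp * W.toOp :=
  List.prod_append

theorem QCircuit.complexity_append {Q : Type} [Fintype Q] [DecidableEq Q] (V W : QCircuit Q) :
    (V.append W).complexity = V.complexity + W.complexity :=
  List.length_append

theorem IsTwoQubitGate.conjTranspose {Q : Type} [Fintype Q] [DecidableEq Q] {U : QOp Q}
    (hU : IsTwoQubitGate U) : IsTwoQubitGate U.conjTranspose := by
  obtain ⟨hU, i, j, B, hB⟩ := hU
  refine ⟨Unitary.star_mem hU, i, j, B.conjTranspose, fun x y => ?_⟩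
  rw [Matrix.conjTranspose_apply, hB, Matrix.conjTranspose_apply]
  simp only [eq_comm (a := y _)]
  split_ifs <;> simp

/-- The circuit run backwards. -/
def QCircuit.inverse {Q : Type} [Fintype Q] [DecidableEq Q] (V : QCircuit Q) : QCircuit Q where
  gates := (V.gates.map Matrix.conjTranspose).reverse
  isGate U hU := by
    obtain ⟨U', hU', rfl⟩ := List.mem_map.1 (List.mem_reverse.1 hU)
    exact (V.isGate U' hU').conjTranspose

theorem QCircuit.toOp_inverse {Q : Type} [Fintype Q] [DecidableEq Q] (V : QCircuit Q) :
    V.inverse.toOp = V.toOp.conjTranspose :=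
  (Matrix.conjTranspose_list_prod V.gates).symm

theorem QCircuit.complexity_inverse {Q : Type} [Fintype Q] [DecidableEq Q] (V : QCircuit Q) :
    V.inverse.complexity = V.complexity := by
  simp [complexity, inverse]

/-- The circuit of a single gate. -/
def QCircuit.ofGate {Q : Type} [Fintype Q] [DecidableEq Q] (U : QOp Q) (hU : IsTwoQubitGate U) :
    QCircuit Q where
  gates := [U]
  isGate _ h := List.mem_singleton.1 h ▸ hU

theorem QCircuit.toOp_ofGate {Q : Type} [Fintype Q] [DecidableEq Q] (U : QOp Q)
    (hU : IsTwoQubitGate U) : (QCircuit.ofGate U hU).toOp = U :=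
  List.prod_singleton

theorem Implementable.one :
    Implementable f (1 : Matrix ((Fin n → Fin 2) × Y) ((Fin n → Fin 2) × Y) ℂ) 0 :=
  ⟨⟨[], by simp⟩, le_rfl, by simp [QCircuit.toOp]⟩

theorem Implementable.mul {M N : Matrix ((Fin n → Fin 2) × Y) ((Fin n → Fin 2) × Y) ℂ} {G G' : ℕ}
    (hM : Implementable f M G) (hN : Implementable f N G') : Implementable f (M * N) (G + G') := by
  obtain ⟨V, hV, hVM⟩ := hM
  obtain ⟨W, hW, hWN⟩ := hN
  refine ⟨V.append W, ?_, ?_⟩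
  · rw [QCircuit.complexity_append]
    exact add_le_add hV hW
  · rw [QCircuit.toOp_append, Matrix.mul_assoc, hWN, ← Matrix.mul_assoc, hVM, Matrix.mul_assoc]

/-- The circuit is only specified on the encoded space. Unitarity of `M` makes it map that space
onto itself, so the reversed circuit implements the adjoint there. -/
theorem Implementable.conjTranspose
    {M : Matrix ((Fin n → Fin 2) × Y) ((Fin n → Fin 2) × Y) ℂ} {G : ℕ}
    (hM : Implementable f M G) (hu : M ∈ Matrix.unitaryGroup _ ℂ) :
    Implementable f M.conjTranspose G := by
  obtain ⟨V, hV, hVM⟩ := hM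
  refine ⟨V.inverse, by rwa [QCircuit.complexity_inverse], ?_⟩
  have h1 := Matrix.mem_unitaryGroup_iff'.1 V.toOp_mem_unitary
  have h2 := Matrix.mem_unitaryGroup_iff.1 hu
  rw [Matrix.star_eq_conjTranspose] at h1 h2
  rw [QCircuit.toOp_inverse]
  calc V.toOp.conjTranspose * encodeMatrix n f
      = V.toOp.conjTranspose * (encodeMatrix n f * M) * M.conjTranspose := by
        rw [Matrix.mul_assoc, Matrix.mul_assoc, h2, Matrix.mul_one]
    _ = encodeMatrix n f * M.conjTranspose := by
        rw [← hVM, ← Matrix.mul_assoc, h1, Matrix.one_mul]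

theorem Implementable.ofGate {M : Matrix ((Fin n → Fin 2) × Y) ((Fin n → Fin 2) × Y) ℂ}
    {U : QOp (Fin n ⊕ Fin a)} (hU : IsTwoQubitGate U)
    (h : ∀ l, U.mulVec (ket (encode f l)) = (encodeMatrix n f).mulVec (M.mulVec (ket l))) :
    Implementable f M 1 := by
  refine ⟨QCircuit.ofGate U hU, le_rfl, Matrix.ext_of_mulVec_ket fun l => ?_⟩
  rw [QCircuit.toOp_ofGate, ← Matrix.mulVec_mulVec, ← Matrix.mulVec_mulVec,
    encodeMatrix_mulVec_ket, h]

theorem atQubit_mulVec_ket (k : Fin n) (A : Matrix (Fin 2 × Y) (Fin 2 × Y) ℂ) (x : Fin n → Fin 2)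
    (y : Y) : (atQubit k A).mulVec (ket (x, y)) =
      ∑ c, A c (x k, y) • ket (Function.update x k c.1, c.2) := by
  ext l
  have hl : ∀ c : Fin 2 × Y, l = (Function.update x k c.1, c.2) ↔
      c = (l.1 k, l.2) ∧ ∀ j, j ≠ k → l.1 j = x j := by
    intro c
    constructor
    · rintro rfl
      exact ⟨by simp, fun j hj => by simp [hj]⟩
    · rintro ⟨rfl, h⟩
      refine Prod.ext (funext fun j => ?_) rfl
      rcases eq_or_ne j k with rfl | hj
      · simp
      · simp [hj, h j hj]
  simp only [mulVec_ket_apply, Finset.sum_apply, Pi.smul_apply, Pi.single_apply, hl, smul_eq_mul,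
    mul_ite, mul_one, mul_zero, ite_and, Finset.sum_ite_eq', Finset.mem_univ, if_true]
  rfl

theorem encode_update_hop (hf : Function.Injective f) {y y' : Y} (h : y ≠ y')
    (x : Fin n → Fin 2) :
    Function.update (Function.update (encode f (x, y)) (Sum.inr (f y)) 0) (Sum.inr (f y')) 1 =
      encode f (x, y') := by
  have hne := hf.ne h
  ext1 q
  rcases q with q | q
  · simp
  · rcases eq_or_ne q (f y') with rfl | hq
    · simp
    · rcases eq_or_ne q (f y) with rfl | hq'
      · simp [hne]
      · simp [hq, hq']

/-- A particle hopping between two sites is a two-qubit gate. -/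
theorem Implementable.hop (hf : Function.Injective f) {y y' : Y} (h : y ≠ y')
    {u : Matrix (Fin 2) (Fin 2) ℂ} (hu : u ∈ Matrix.unitaryGroup (Fin 2) ℂ) :
    Implementable f ((1 : Matrix (Fin n → Fin 2) _ ℂ) ⊗ₖ twoLevel y y' u) 1 := by
  have hne := hf.ne h
  have hij : (Sum.inr (f y) : Fin n ⊕ Fin a) ≠ Sum.inr (f y') := by simpa using hne
  -- With a single particle the two ancillas are in state 10, 01 or 00: `u` acts on the span of the
  -- first two, and the gate is the identity on 00.
  refine Implementable.ofGate (U := pairGate (Sum.inr (f y)) (Sum.inr (f y'))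
    (twoLevel (1, 0) (0, 1) u)) (pairGate_isTwoQubitGate hij (twoLevel_mem_unitary (by simp) hu)) ?_
  rintro ⟨x, z⟩
  rw [pairGate_mulVec_ket hij, one_kronecker_mulVec_ket, Matrix.mulVec_sum]
  simp only [Matrix.mulVec_smul, encodeMatrix_mulVec_ket]
  rw [sum_twoLevel_smul, sum_twoLevel_smul]
  have h1 : (Function.update (Function.update (encode f (x, z)) (Sum.inr (f y))
      (encode f (x, z) (Sum.inr (f y)))) (Sum.inr (f y')) (encode f (x, z) (Sum.inr (f y')))) =
      encode f (x, z) := by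
    rw [Function.update_eq_self, Function.update_eq_self]
  dsimp only
  rw [h1]
  rcases eq_or_ne z y with rfl | hzy
  · have e1 : (encode f (x, z) (Sum.inr (f z)), encode f (x, z) (Sum.inr (f y'))) =
        ((1, 0) : Fin 2 × Fin 2) := by simp [hne.symm]
    have e2 : Function.update (Function.update (encode f (x, z)) (Sum.inr (f z)) 1)
        (Sum.inr (f y')) 0 = encode f (x, z) := by
      simp only [Prod.mk.injEq] at e1
      rw [e1.1, e1.2] at h1
      exact h1
    rw [e1, e2, encode_update_hop hf h]
    simp [h]
  rcases eq_or_ne z y' with rfl | hzy'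
  · have e1 : (encode f (x, z) (Sum.inr (f y)), encode f (x, z) (Sum.inr (f z))) =
        ((0, 1) : Fin 2 × Fin 2) := by simp [hne]
    have e2 : Function.update (Function.update (encode f (x, z)) (Sum.inr (f y)) 0)
        (Sum.inr (f z)) 1 = encode f (x, z) := by
      simp only [Prod.mk.injEq] at e1
      rw [e1.1, e1.2] at h1
      exact h1
    rw [e1, e2, Function.update_comm hij, encode_update_hop hf h.symm]
    simp [hzy]
  · have e1 : (encode f (x, z) (Sum.inr (f y)), encode f (x, z) (Sum.inr (f y'))) =
        ((0, 0) : Fin 2 × Fin 2) := by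
      simp [hf.ne hzy.symm, hf.ne hzy'.symm]
    rw [e1]
    simp [hzy, hzy']

/-- A one-qubit gate controlled by the presence of the particle is a two-qubit gate. -/
theorem Implementable.control (hf : Function.Injective f) (k : Fin n) (y : Y)
    {g : Matrix (Fin 2) (Fin 2) ℂ} (hg : g ∈ Matrix.unitaryGroup (Fin 2) ℂ) :
    Implementable f (atQubit k (Matrix.blockDiagonal fun z => if z = y then g else 1)) 1 := by
  have hij : (Sum.inl k : Fin n ⊕ Fin a) ≠ Sum.inr (f y) := by simp
  refine Implementable.ofGate (U := pairGate (Sum.inl k) (Sum.inr (f y))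
    (Matrix.blockDiagonal fun c => if c = 1 then g else 1)) (pairGate_isTwoQubitGate hij
      (blockDiagonal_mem_unitary fun c => ?_)) ?_
  · split_ifs
    exacts [hg, one_mem _]
  rintro ⟨x, z⟩
  rw [pairGate_mulVec_ket hij, atQubit_mulVec_ket, Matrix.mulVec_sum]
  simp only [Matrix.mulVec_smul, encodeMatrix_mulVec_ket]
  rw [sum_blockDiagonal_smul, sum_blockDiagonal_smul]
  refine Finset.sum_congr rfl fun s _ => ?_
  have h1 : Function.update (Function.update (encode f (x, z)) (Sum.inl k) s) (Sum.inr (f y))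
      (encode f (x, z) (Sum.inr (f y))) = encode f (Function.update x k s, z) := by
    ext1 q
    rcases q with q | q
    · rcases eq_or_ne q k with rfl | hq
      · simp
      · simp [hq]
    · rcases eq_or_ne q (f y) with rfl | hq
      · simp
      · simp [hq]
  dsimp only
  rw [h1]
  have h2 : encode f (x, z) (Sum.inr (f y)) = 1 ↔ z = y := by
    simp [hf.eq_iff, eq_comm]
  simp only [h2]
  rfl

end Implementable

/-! ### Operators on a qubit and the site of the particle -/

section AtQubit

variable {n a : ℕ} {Y : Type} [Fintype Y] [DecidableEq Y] {f : Y → Fin a}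

theorem atQubit_mul (k : Fin n) (A B : Matrix (Fin 2 × Y) (Fin 2 × Y) ℂ) :
    atQubit k (A * B) = atQubit k A * atQubit k B := by
  refine Matrix.ext_of_mulVec_ket ?_
  rintro ⟨x, y⟩
  rw [← Matrix.mulVec_mulVec, atQubit_mulVec_ket, atQubit_mulVec_ket, Matrix.mulVec_sum]
  simp only [Matrix.mulVec_smul, atQubit_mulVec_ket, Finset.smul_sum, Function.update_self,
    Function.update_idem, Matrix.mul_apply, Finset.sum_smul, smul_smul]
  rw [Finset.sum_comm]
  simp only [mul_comm]

theorem atQubit_add (k : Fin n) (A B : Matrix (Fin 2 × Y) (Fin 2 × Y) ℂ) :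
    atQubit k (A + B) = atQubit k A + atQubit k B := by
  ext l l'
  simp only [atQubit, Matrix.of_apply, Matrix.add_apply]
  split_ifs <;> simp

theorem atQubit_one_kronecker (k : Fin n) (A : Matrix Y Y ℂ) :
    atQubit k ((1 : Matrix (Fin 2) (Fin 2) ℂ) ⊗ₖ A) = (1 : Matrix (Fin n → Fin 2) _ ℂ) ⊗ₖ A := by
  refine Matrix.ext_of_mulVec_ket ?_
  rintro ⟨x, y⟩
  rw [atQubit_mulVec_ket, one_kronecker_mulVec_ket, Fintype.sum_prod_type,
    Finset.sum_eq_single (x k)]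
  · simp
  · intro b _ hb
    simp [Matrix.one_apply_ne hb]
  · simp

theorem atQubit_one (k : Fin n) :
    atQubit k (1 : Matrix (Fin 2 × Y) (Fin 2 × Y) ℂ) = 1 := by
  rw [← Matrix.one_kronecker_one, atQubit_one_kronecker, Matrix.one_kronecker_one]

/-- The site operator `P` controlled by the qubit. -/
def qubitControl (P : Matrix Y Y ℂ) : Matrix (Fin 2 × Y) (Fin 2 × Y) ℂ :=
  Matrix.single 0 0 1 ⊗ₖ 1 + Matrix.single 1 1 1 ⊗ₖ P

/-- The conjugating operators need no control: in the idle branch they cancel. -/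
theorem qubitControl_conj (A B P : Matrix Y Y ℂ) (hAB : A * B = 1) :
    ((1 : Matrix (Fin 2) (Fin 2) ℂ) ⊗ₖ A) * qubitControl P *
      ((1 : Matrix (Fin 2) (Fin 2) ℂ) ⊗ₖ B) = qubitControl (A * P * B) := by
  simp only [qubitControl, Matrix.mul_add, Matrix.add_mul, ← Matrix.mul_kronecker_mul, one_mul,
    mul_one, hAB]

theorem qubitControl_mul (P P' : Matrix Y Y ℂ) :
    qubitControl (P * P') = qubitControl P * qubitControl P' := by
  simp only [qubitControl, Matrix.mul_add, Matrix.add_mul, ← Matrix.mul_kronecker_mul]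
  simp

theorem qubitControl_one : qubitControl (1 : Matrix Y Y ℂ) = 1 := by
  rw [qubitControl, ← Matrix.add_kronecker]
  have : Matrix.single 0 0 1 + Matrix.single 1 1 1 = (1 : Matrix (Fin 2) (Fin 2) ℂ) := by
    ext i j
    fin_cases i <;> fin_cases j <;> simp
  rw [this, Matrix.one_kronecker_one]

/-! ### Controlled permutations of the sites -/

/-- The matrix of a permutation of the sites. -/
def permOp (σ : Equiv.Perm Y) : Matrix Y Y ℂ :=
  Matrix.of fun z w => if z = σ w then 1 else 0

theorem permOp_mulVec_ket (σ : Equiv.Perm Y) (y : Y) : (permOp σ).mulVec (ket y) = ket (σ y) := by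
  ext z
  exact (mulVec_ket_apply _ _ _).trans (Pi.single_apply _ _ _).symm

theorem permOp_mul (σ τ : Equiv.Perm Y) : permOp (σ * τ) = permOp σ * permOp τ := by
  refine Matrix.ext_of_mulVec_ket fun y => ?_
  rw [← Matrix.mulVec_mulVec, permOp_mulVec_ket, permOp_mulVec_ket, permOp_mulVec_ket]
  rfl

theorem permOp_one : permOp (1 : Equiv.Perm Y) = 1 := by
  refine Matrix.ext_of_mulVec_ket fun y => ?_
  rw [permOp_mulVec_ket, Matrix.one_mulVec]
  rfl

theorem twoLevel_swap {y y' : Y} (h : y ≠ y') :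
    twoLevel y y' !![0, 1; 1, 0] = permOp (Equiv.swap y y') := by
  refine Matrix.ext_of_mulVec_ket fun z => ?_
  rw [permOp_mulVec_ket, mulVec_ket_eq_sum, sum_twoLevel_smul]
  rcases eq_or_ne z y with rfl | hy
  · simp [h]
  rcases eq_or_ne z y' with rfl | hy'
  · simp [hy]
  · simp [hy, hy', Equiv.swap_apply_of_ne_of_ne hy hy']

/-- The Hadamard matrix. -/
noncomputable def hadamard : Matrix (Fin 2) (Fin 2) ℂ := ((√2 : ℝ) : ℂ)⁻¹ • !![1, 1; 1, -1]

theorem hadamard_mul_self : hadamard * hadamard = 1 := by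
  have h2 : (((√2 : ℝ) : ℂ)⁻¹ * ((√2 : ℝ) : ℂ)⁻¹) = 2⁻¹ := by
    rw [← mul_inv, ← Complex.ofReal_mul, Real.mul_self_sqrt zero_le_two, Complex.ofReal_ofNat]
  rw [hadamard, Matrix.smul_mul, Matrix.mul_smul, smul_smul, h2]
  ext i j
  fin_cases i <;> fin_cases j <;> simp <;> norm_num

theorem hadamard_mem_unitary : hadamard ∈ Matrix.unitaryGroup (Fin 2) ℂ := by
  have h : star hadamard = hadamard := by
    ext i j
    fin_cases i <;> fin_cases j <;> simp [hadamard, Matrix.star_apply]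
  rw [Matrix.mem_unitaryGroup_iff, h, hadamard_mul_self]

theorem hadamard_conj : hadamard * !![1, 0; 0, -1] * hadamard = !![0, 1; 1, 0] := by
  have h2 : (((√2 : ℝ) : ℂ)⁻¹ * ((√2 : ℝ) : ℂ)⁻¹) = 2⁻¹ := by
    rw [← mul_inv, ← Complex.ofReal_mul, Real.mul_self_sqrt zero_le_two, Complex.ofReal_ofNat]
  rw [hadamard, Matrix.smul_mul, Matrix.smul_mul, Matrix.mul_smul, smul_smul, h2]
  ext i j
  fin_cases i <;> fin_cases j <;> simp <;> norm_num

/-- A controlled sign is symmetric in control and target: a sign at the site `y'` controlled by the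
qubit is a Z on the qubit controlled by the site. -/
theorem qubitControl_phase {y y' : Y} :
    qubitControl (twoLevel y y' !![1, 0; 0, -1]) =
      Matrix.blockDiagonal fun z => if z = y' then !![1, 0; 0, -1] else 1 := by
  have h : twoLevel y y' !![1, 0; 0, -1] = Matrix.diagonal fun z => if z = y' then -1 else 1 := by
    ext z w
    rw [twoLevel_apply, Matrix.diagonal_apply]
    rcases eq_or_ne z w with rfl | hzw
    · by_cases hz : z = y'
      · simp [hz]
      · simp [hz]
    · by_cases hz : z = y'
      · have hw : w ≠ y' := fun h => hzw (hz.trans h.symm)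
        simp [hzw, hw]
      · simp [hzw, hz]
  rw [h]
  ext ⟨s, z⟩ ⟨s', w⟩
  rw [Matrix.blockDiagonal_apply]
  rcases eq_or_ne z w with rfl | hzw
  · fin_cases s <;> fin_cases s' <;> by_cases hz : z = y' <;> simp [qubitControl, hz]
  · simp [qubitControl, hzw]

/-- Swapping two sites under the control of a qubit takes three gates. -/
theorem Implementable.controlSwap (hf : Function.Injective f) (k : Fin n) {y y' : Y} (h : y ≠ y') :
    Implementable f (atQubit k (qubitControl (permOp (Equiv.swap y y')))) 3 := by
  have hZ : (!![1, 0; 0, -1] : Matrix (Fin 2) (Fin 2) ℂ) ∈ Matrix.unitaryGroup (Fin 2) ℂ := by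
    rw [Matrix.mem_unitaryGroup_iff]
    ext i j
    fin_cases i <;> fin_cases j <;> simp [Matrix.mul_apply, Fin.sum_univ_two]
  -- A swap is a Z conjugated by Hadamards. The Hadamards are uncontrolled hops, and the controlled
  -- Z is a one-qubit gate controlled by the particle.
  have h1 := Implementable.hop (n := n) hf h hadamard_mem_unitary
  have h2 := Implementable.control hf k y' hZ
  have h3 := (h1.mul h2).mul h1
  rw [← qubitControl_phase (y := y), ← atQubit_one_kronecker k, ← atQubit_mul, ← atQubit_mul,
    qubitControl_conj _ _ _ (by rw [twoLevel_mul h, hadamard_mul_self, twoLevel_one]),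
    twoLevel_mul h, twoLevel_mul h, hadamard_conj, twoLevel_swap h] at h3
  exact h3

/-- Permuting the sites under the control of a qubit. -/
theorem Implementable.controlPerm (hf : Function.Injective f) (k : Fin n) (σ : Equiv.Perm Y) :
    Implementable f (atQubit k (qubitControl (permOp σ))) (3 * Fintype.card Y) := by
  have key : ∀ (m : ℕ) (σ : Equiv.Perm Y), σ.support.card = m →
      Implementable f (atQubit k (qubitControl (permOp σ))) (3 * m) := by
    intro m
    induction m using Nat.strong_induction_on with
    | _ m ih =>
      intro σ hσ
      by_cases h1 : σ = 1
      · rw [h1, permOp_one, qubitControl_one, atQubit_one]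
        exact Implementable.one.mono (Nat.zero_le _)
      · obtain ⟨x, hx⟩ := not_forall.1 (mt Equiv.Perm.ext h1)
        have hx' : σ x ≠ x := hx
        have hlt := Equiv.Perm.card_support_swap_mul hx'
        -- Multiplying `σ` by the swap of `x` and `σ x` fixes `x` and shrinks the support; undoing
        -- the swap costs three gates.
        have h2 := (Implementable.controlSwap hf k hx'.symm).mul (ih _ (hσ ▸ hlt) _ rfl)
        rw [← atQubit_mul, ← qubitControl_mul, ← permOp_mul, ← mul_assoc, Equiv.swap_mul_self,
          one_mul] at h2
        exact h2.mono (by omega)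
  exact (key _ σ rfl).mono (Nat.mul_le_mul_left _ (Finset.card_le_univ _))

/-- One-qubit gates that depend on the site. -/
theorem Implementable.controlAll (hf : Function.Injective f) (k : Fin n)
    {g : Y → Matrix (Fin 2) (Fin 2) ℂ} (hg : ∀ y, g y ∈ Matrix.unitaryGroup (Fin 2) ℂ) :
    Implementable f (atQubit k (Matrix.blockDiagonal g)) (Fintype.card Y) := by
  have key : ∀ s : Finset Y, Implementable f
      (atQubit k (Matrix.blockDiagonal fun z => if z ∈ s then g z else 1)) s.card := by
    intro s
    induction s using Finset.induction_on with
    | empty =>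
      have : (Matrix.blockDiagonal fun z : Y => if z ∈ (∅ : Finset Y) then g z else 1) = 1 := by
        simp only [Finset.notMem_empty, if_false]
        exact Matrix.blockDiagonal_one
      rw [this, atQubit_one]
      exact Implementable.one
    | insert y s hy ih =>
      have h := (Implementable.control hf k y (hg y)).mul ih
      rw [← atQubit_mul, ← Matrix.blockDiagonal_mul] at h
      have heq : (fun z => (if z = y then g y else 1) * if z ∈ s then g z else 1) =
          fun z => if z ∈ insert y s then g z else 1 := by
        ext1 z
        rcases eq_or_ne z y with rfl | hz
        · simp [hy]
        · simp [hz]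
      rw [heq] at h
      rw [Finset.card_insert_of_notMem hy]
      exact h.mono (by omega)
  have h := key Finset.univ
  simp only [Finset.mem_univ, if_true] at h
  exact h

/-! ### Unitaries on the sites -/

/-- The phase `c` at the site `y`. -/
def sitePhase (y : Y) (c : ℂ) : Matrix Y Y ℂ :=
  Matrix.diagonal fun z => if z = y then c else 1

theorem sitePhase_mem_unitary (y : Y) {c : ℂ} (hc : star c * c = 1) :
    sitePhase y c ∈ Matrix.unitaryGroup Y ℂ := by
  rw [Matrix.mem_unitaryGroup_iff', sitePhase, Matrix.star_eq_conjTranspose,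
    Matrix.diagonal_conjTranspose, Matrix.diagonal_mul_diagonal, ← Matrix.diagonal_one]
  congr 1
  ext1 z
  rcases eq_or_ne z y with rfl | hz
  · simpa using hc
  · simp [hz]

/-- A scalar applied to a qubit under the control of a site is a phase of that site. The qubit `k`
is a mere spectator. -/
theorem Implementable.phase (hf : Function.Injective f) (k : Fin n) (y : Y) {c : ℂ}
    (hc : star c * c = 1) :
    Implementable f ((1 : Matrix (Fin n → Fin 2) _ ℂ) ⊗ₖ sitePhase y c) 1 := by
  have hu : (c • 1 : Matrix (Fin 2) (Fin 2) ℂ) ∈ Matrix.unitaryGroup (Fin 2) ℂ := by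
    rw [Matrix.mem_unitaryGroup_iff', star_smul, star_one, Matrix.smul_mul, Matrix.mul_smul,
      smul_smul, mul_one, hc, one_smul]
  have h := Implementable.control hf k y hu
  have heq : (Matrix.blockDiagonal fun z => if z = y then c • 1 else 1) =
      (1 : Matrix (Fin 2) (Fin 2) ℂ) ⊗ₖ sitePhase y c := by
    ext ⟨s, z⟩ ⟨s', w⟩
    rw [Matrix.blockDiagonal_apply, Matrix.kroneckerMap_apply, sitePhase,
      Matrix.diagonal_apply]
    split_ifs <;> simp [mul_comm]
  rwa [heq, atQubit_one_kronecker] at h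

/-- A complex Givens rotation; the zero vector is treated apart because it cannot be normalised. -/
theorem exists_unitary_annihilating (a b : ℂ) :
    ∃ u ∈ Matrix.unitaryGroup (Fin 2) ℂ, u 1 0 * a + u 1 1 * b = 0 := by
  by_cases h : Complex.normSq a + Complex.normSq b = 0
  · have ha : a = 0 := Complex.normSq_eq_zero.1
      (le_antisymm (by linarith [Complex.normSq_nonneg b]) (Complex.normSq_nonneg a))
    have hb : b = 0 := Complex.normSq_eq_zero.1
      (le_antisymm (by linarith [Complex.normSq_nonneg a]) (Complex.normSq_nonneg b))
    exact ⟨1, one_mem _, by simp [ha, hb]⟩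
  · have hpos : 0 < Complex.normSq a + Complex.normSq b :=
      lt_of_le_of_ne (add_nonneg (Complex.normSq_nonneg a) (Complex.normSq_nonneg b)) (Ne.symm h)
    set r : ℝ := √(Complex.normSq a + Complex.normSq b) with hr
    have hrr : (r : ℂ) * r = star a * a + star b * b := by
      rw [← Complex.ofReal_mul, hr, Real.mul_self_sqrt hpos.le, Complex.ofReal_add,
        Complex.normSq_eq_conj_mul_self, Complex.normSq_eq_conj_mul_self]
      rfl
    have hr0 : (r : ℂ) ≠ 0 := by
      rw [Complex.ofReal_ne_zero]
      exact (Real.sqrt_pos.2 hpos).ne'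
    refine ⟨(r : ℂ)⁻¹ • !![star a, star b; -b, a], ?_, ?_⟩
    · rw [Matrix.mem_unitaryGroup_iff, star_smul, Matrix.smul_mul, Matrix.mul_smul, smul_smul]
      have hs : star ((r : ℂ)⁻¹) = (r : ℂ)⁻¹ := by simp
      have hm : !![star a, star b; -b, a] * star !![star a, star b; -b, a] =
          ((r : ℂ) * r) • (1 : Matrix (Fin 2) (Fin 2) ℂ) := by
        rw [hrr]
        ext i j
        fin_cases i <;> fin_cases j <;>
          simp [Matrix.mul_apply, Fin.sum_univ_two, Matrix.star_apply] <;> ring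
      rw [hs, hm, smul_smul]
      have : (r : ℂ)⁻¹ * (r : ℂ)⁻¹ * (r * r) = 1 := by field_simp
      rw [this, one_smul]
    · simp
      ring

theorem twoLevel_mulVec_apply_of_ne {y y' z : Y} (hy : z ≠ y) (hy' : z ≠ y')
    (u : Matrix (Fin 2) (Fin 2) ℂ) (v : Y → ℂ) : (twoLevel y y' u).mulVec v z = v z := by
  simp [Matrix.mulVec, dotProduct, twoLevel_apply, hy, hy']

theorem twoLevel_mulVec_apply_right {y y' : Y} (h : y ≠ y') (u : Matrix (Fin 2) (Fin 2) ℂ)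
    (v : Y → ℂ) : (twoLevel y y' u).mulVec v y' = u 1 0 * v y + u 1 1 * v y' := by
  simp [Matrix.mulVec, dotProduct, twoLevel_apply, h.symm, add_mul, Finset.sum_add_distrib]
  ring

theorem twoLevel_mulVec_ket_of_ne {y y' z : Y} (hy : z ≠ y) (hy' : z ≠ y')
    (u : Matrix (Fin 2) (Fin 2) ℂ) : (twoLevel y y' u).mulVec (ket z) = ket z := by
  rw [mulVec_ket_eq_sum, sum_twoLevel_smul]
  simp [hy, hy']

/-- Each hop between `y₀` and a site of `S` rotates the entry there into `y₀`. Sites outside stay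
fixed, which lets the elimination be iterated without spoiling earlier columns. -/
theorem exists_eliminating (hf : Function.Injective f) (y₀ : Y) (v : Y → ℂ) (S : Finset Y)
    (hS : y₀ ∉ S) : ∃ Q ∈ Matrix.unitaryGroup Y ℂ,
      Implementable f ((1 : Matrix (Fin n → Fin 2) _ ℂ) ⊗ₖ Q) S.card ∧
      (∀ y ∈ S, Q.mulVec v y = 0) ∧ (∀ y ∉ insert y₀ S, Q.mulVec v y = v y) ∧
      ∀ y ∉ insert y₀ S, Q.mulVec (ket y) = ket y := by
  induction S using Finset.induction_on with
  | empty =>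
    refine ⟨1, one_mem _, ?_, by simp, by simp, fun y _ => Matrix.one_mulVec _⟩
    rw [Matrix.one_kronecker_one]
    exact Implementable.one
  | insert y₁ S hy₁ ih =>
    simp only [Finset.mem_insert, not_or] at hS
    obtain ⟨Q, hQ, himp, hzero, hfix, hket⟩ := ih hS.2
    obtain ⟨u, hu, hann⟩ := exists_unitary_annihilating (Q.mulVec v y₀) (Q.mulVec v y₁)
    refine ⟨twoLevel y₀ y₁ u * Q, mul_mem (twoLevel_mem_unitary hS.1 hu) hQ, ?_, ?_, ?_, ?_⟩
    · rw [one_kronecker_mul, Finset.card_insert_of_notMem hy₁, add_comm]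
      exact (Implementable.hop hf hS.1 hu).mul himp
    · intro y hy
      rw [← Matrix.mulVec_mulVec]
      rcases Finset.mem_insert.1 hy with rfl | hy
      · rw [twoLevel_mulVec_apply_right hS.1, hann]
      · rw [twoLevel_mulVec_apply_of_ne (ne_of_mem_of_not_mem hy hS.2)
          (ne_of_mem_of_not_mem hy hy₁), hzero y hy]
    · intro y hy
      simp only [Finset.mem_insert, not_or] at hy
      rw [← Matrix.mulVec_mulVec, twoLevel_mulVec_apply_of_ne hy.1 hy.2.1, hfix y]
      simp [hy]
    · intro y hy
      simp only [Finset.mem_insert, not_or] at hy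
      rw [← Matrix.mulVec_mulVec, hket y (by simp [hy]), twoLevel_mulVec_ket_of_ne hy.1 hy.2.1]

/-- A unitary that moves only the sites in `S` takes at most `|S|²` gates. -/
theorem Implementable.ofUnitary (hf : Function.Injective f) (k : Fin n) (S : Finset Y)
    (U : Matrix Y Y ℂ) (hU : U ∈ Matrix.unitaryGroup Y ℂ)
    (hS : ∀ y ∉ S, U.mulVec (ket y) = ket y) :
    Implementable f ((1 : Matrix (Fin n → Fin 2) _ ℂ) ⊗ₖ U) (S.card ^ 2) := by
  induction S using Finset.induction_on generalizing U with
  | empty =>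
    have : U = 1 := Matrix.ext_of_mulVec_ket fun y => by rw [hS y (by simp), Matrix.one_mulVec]
    rw [this, Matrix.one_kronecker_one]
    exact Implementable.one.mono (Nat.zero_le _)
  | insert y₀ S hy₀ ih =>
    obtain ⟨Q, hQ, himp, hzero, hfix, hket⟩ :=
      exists_eliminating (n := n) hf y₀ (U.mulVec (ket y₀)) S hy₀
    -- `U` fixes these basis vectors, and its column at `y₀` is orthogonal to them.
    have hout : ∀ y ∉ insert y₀ S, U.mulVec (ket y₀) y = 0 := by
      intro y hy
      have hne : y ≠ y₀ := fun h => hy (h ▸ Finset.mem_insert_self _ _)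
      have h := congrFun (congrFun (Matrix.mem_unitaryGroup_iff'.1 hU) y) y₀
      rw [Matrix.mul_apply, Matrix.one_apply_ne hne] at h
      have hcol : ∀ z, star U y z = if z = y then 1 else 0 := by
        intro z
        have := congrFun (hS y hy) z
        rw [mulVec_ket_apply, ket_apply] at this
        rw [Matrix.star_apply, this]
        split_ifs <;> simp
      simpa [hcol] using h
    have hQU : (Q * U).mulVec (ket y₀) = (Q * U) y₀ y₀ • ket y₀ := by
      ext y
      rcases eq_or_ne y y₀ with rfl | hne
      · simp
      · rw [Pi.smul_apply, ket_apply, if_neg hne, smul_zero, ← Matrix.mulVec_mulVec]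
        by_cases hy : y ∈ S
        · exact hzero y hy
        · have hy' : y ∉ insert y₀ S := by simp [hne, hy]
          rw [hfix y hy', hout y hy']
    set c : ℂ := (Q * U) y₀ y₀
    have hc : star c * c = 1 := by
      have h := congrFun (congrFun (Matrix.mem_unitaryGroup_iff'.1 (mul_mem hQ hU)) y₀) y₀
      rw [Matrix.mul_apply, Matrix.one_apply_eq, Finset.sum_eq_single y₀] at h
      · exact h
      · intro z _ hz
        have := congrFun hQU z
        rw [mulVec_ket_apply, Pi.smul_apply, ket_apply, if_neg hz, smul_zero] at this
        rw [this, mul_zero]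
      · simp
    have hc' : star (star c) * star c = 1 := by rw [star_star, mul_comm, hc]
    have hP := sitePhase_mem_unitary y₀ hc'
    have hdiag : ∀ y, (sitePhase y₀ (star c)).mulVec (ket y) =
        (if y = y₀ then star c else 1) • ket y := by
      intro y
      ext z
      rw [mulVec_ket_apply, sitePhase, Matrix.diagonal_apply, Pi.smul_apply, ket_apply]
      rcases eq_or_ne z y with rfl | hz
      · simp
      · simp [hz]
    -- After elimination and a phase correction `y₀` is fixed as well, so the remaining unitary
    -- moves only sites of `S`.
    have hU' := ih (sitePhase y₀ (star c) * (Q * U)) (mul_mem hP (mul_mem hQ hU)) (by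
      intro y hy
      rw [← Matrix.mulVec_mulVec]
      rcases eq_or_ne y y₀ with rfl | hne
      · rw [hQU, Matrix.mulVec_smul, hdiag, if_pos rfl, smul_smul, mul_comm, hc, one_smul]
      · have hy' : y ∉ insert y₀ S := by simp [hne, hy]
        rw [← Matrix.mulVec_mulVec, hS y hy', hket y hy', hdiag, if_neg hne, one_smul])
    have hPi := Implementable.phase (n := n) hf k y₀ hc'
    have h := (himp.conjTranspose (Matrix.kronecker_mem_unitary (one_mem _) hQ)).mul
      ((hPi.conjTranspose (Matrix.kronecker_mem_unitary (one_mem _) hP)).mul hU')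
    rw [one_kronecker_conjTranspose, one_kronecker_conjTranspose, ← one_kronecker_mul,
      ← one_kronecker_mul, ← Matrix.mul_assoc _ _ (Q * U), ← Matrix.star_eq_conjTranspose,
      ← Matrix.star_eq_conjTranspose, Matrix.mem_unitaryGroup_iff'.1 hP, Matrix.one_mul,
      ← Matrix.mul_assoc, Matrix.mem_unitaryGroup_iff'.1 hQ, Matrix.one_mul] at h
    rw [Finset.card_insert_of_notMem hy₀]
    -- With s = `S.card`: s hops, one phase and s² gates by induction, at most (s + 1)² in total.
    exact h.mono (by nlinarith)

end AtQubit

/-- A unitary that is block diagonal takes a number of gates that is the sum of the squares of the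
sizes of the blocks. -/
theorem Implementable.blockDiagonal {n a : ℕ} {X Y : Type} [Fintype X] [DecidableEq X] [Fintype Y]
    [DecidableEq Y] {f : X × Y → Fin a} (hf : Function.Injective f) (k : Fin n)
    {u : Y → Matrix X X ℂ} (hu : ∀ y, u y ∈ Matrix.unitaryGroup X ℂ) :
    Implementable f ((1 : Matrix (Fin n → Fin 2) _ ℂ) ⊗ₖ Matrix.blockDiagonal u)
      (Fintype.card Y * Fintype.card X ^ 2) := by
  have key : ∀ s : Finset Y, Implementable f ((1 : Matrix (Fin n → Fin 2) _ ℂ) ⊗ₖ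
      Matrix.blockDiagonal fun y => if y ∈ s then u y else 1) (s.card * Fintype.card X ^ 2) := by
    intro s
    induction s using Finset.induction_on with
    | empty =>
      have : (Matrix.blockDiagonal fun z : Y => if z ∈ (∅ : Finset Y) then u z else 1) = 1 := by
        simp only [Finset.notMem_empty, if_false]
        exact Matrix.blockDiagonal_one
      rw [this, Matrix.one_kronecker_one]
      exact Implementable.one.mono (Nat.zero_le _)
    | insert y s hy ih =>
      -- The block of `y` moves only the sites over `y`, of which there are `Fintype.card X`.
      have h1 := Implementable.ofUnitary hf k (Finset.univ ×ˢ {y})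
        (Matrix.blockDiagonal fun z => if z = y then u y else 1)
        (blockDiagonal_mem_unitary fun z => by split_ifs; exacts [hu y, one_mem _]) (by
          rintro ⟨x, z⟩ hz
          have hz' : z ≠ y := fun h => hz (by simp [h])
          rw [mulVec_ket_eq_sum, sum_blockDiagonal_smul, if_neg hz', Finset.sum_eq_single x]
          · simp
          · intro b _ hb
            rw [Matrix.one_apply_ne hb, zero_smul]
          · simp)
      have h := h1.mul ih
      rw [← one_kronecker_mul, ← Matrix.blockDiagonal_mul] at h
      have heq : (fun z => (if z = y then u y else 1) * if z ∈ s then u z else 1) =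
          fun z => if z ∈ insert y s then u z else 1 := by
        ext1 z
        rcases eq_or_ne z y with rfl | hz
        · simp [hy]
        · simp [hz]
      rw [heq] at h
      refine h.mono ?_
      rw [Finset.card_insert_of_notMem hy, Finset.card_product, Finset.card_singleton,
        Finset.card_univ, mul_one, add_mul, one_mul, add_comm]
  have h := key Finset.univ
  simp only [Finset.mem_univ, if_true] at h
  exact h

/-! ### The Schur transform -/

/-- The sites: the number of qubits in state `|1⟩` and the length of the second row of the Young
diagram. -/
abbrev YoungSite (n : ℕ) : Type := Fin (n + 2) × Fin (n + 2)

/-- The site with `m` qubits in state `|1⟩` and a second row of length `r`. -/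
def youngSite (n m r : ℕ) : YoungSite n := (Fin.ofNat (n + 2) m, Fin.ofNat (n + 2) r)

/-- The square root of a natural number, as a complex number. -/
noncomputable def natSqrt (a : ℕ) : ℂ := ((√(a : ℝ) : ℝ) : ℂ)

theorem natSqrt_mul_self (a : ℕ) : natSqrt a * natSqrt a = a := by
  rw [natSqrt, ← Complex.ofReal_mul, Real.mul_self_sqrt (Nat.cast_nonneg a), Complex.ofReal_natCast]

theorem natSqrt_zero : natSqrt 0 = 0 := by
  simp [natSqrt]

theorem star_natSqrt (a : ℕ) : star (natSqrt a) = natSqrt a :=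
  Complex.conj_ofReal _

@[simp]
theorem conj_natSqrt (a : ℕ) : (starRingEnd ℂ) (natSqrt a) = natSqrt a :=
  Complex.conj_ofReal _

/-- The Clebsch-Gordan rotation. -/
noncomputable def couplingRotation (a b : ℕ) : Matrix (Fin 2) (Fin 2) ℂ :=
  if a + b = 0 then 1 else
    (natSqrt (a + b))⁻¹ • !![natSqrt b, natSqrt a; -natSqrt a, natSqrt b]

theorem couplingRotation_mem_unitary (a b : ℕ) : couplingRotation a b ∈ Matrix.unitaryGroup (Fin 2) ℂ := by
  rw [couplingRotation]
  split_ifs with h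
  · exact one_mem _
  · have hab : ((a : ℂ) + b) ≠ 0 := by exact_mod_cast h
    have hm : !![natSqrt b, natSqrt a; -natSqrt a, natSqrt b] *
        star !![natSqrt b, natSqrt a; -natSqrt a, natSqrt b] =
          ((a : ℂ) + b) • (1 : Matrix (Fin 2) (Fin 2) ℂ) := by
      rw [← natSqrt_mul_self a, ← natSqrt_mul_self b]
      ext i j
      fin_cases i <;> fin_cases j <;>
        simp [Matrix.mul_apply, Fin.sum_univ_two, Matrix.star_apply] <;> ring
    rw [Matrix.mem_unitaryGroup_iff, star_smul, Matrix.smul_mul, Matrix.mul_smul, smul_smul, hm,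
      smul_smul, star_inv₀, star_natSqrt, ← mul_inv, natSqrt_mul_self, Nat.cast_add,
      inv_mul_cancel₀ hab, one_smul]

/-- The lowering operator of the representation that belongs to a Young diagram with `k` boxes and
a second row of length `r`. -/
noncomputable def lowering (n k : ℕ) (r : Fin (n + 2)) : Matrix (Fin (n + 2)) (Fin (n + 2)) ℂ :=
  Matrix.of fun m' m => if (m' : ℕ) + 1 = m then
    natSqrt ((m : ℕ) - (r : ℕ)) * natSqrt (k + 1 - r - m) else 0

/-- One more box in the first column. -/
def addOne (n : ℕ) : Equiv.Perm (Fin (n + 2)) := Equiv.addRight 1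

/-- The Clebsch-Gordan transform, coupling one more qubit. -/
noncomputable def clebschGordan (n k : ℕ) :
    Matrix (Fin 2 × YoungSite n) (Fin 2 × YoungSite n) ℂ :=
  qubitControl (permOp ((Equiv.refl _).prodCongr (addOne n))) *
    (Matrix.blockDiagonal fun y : YoungSite n =>
      couplingRotation ((y.1 : ℕ) - y.2) (k + 1 - y.2 - y.1)) *
    qubitControl (permOp ((addOne n).prodCongr (Equiv.refl _)))

/-! ### Clebsch-Gordan and ladder operators on basis states -/

theorem qubitControl_mulVec_ket {Y : Type} [Fintype Y] [DecidableEq Y] (P : Matrix Y Y ℂ)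
    (s : Fin 2) (y : Y) : (qubitControl P).mulVec (ket (s, y)) =
      if s = 0 then ket (s, y) else ∑ z, P z y • ket (s, z) := by
  have h : ∀ (A : Matrix Y Y ℂ) (t : Fin 2), (Matrix.single t t (1 : ℂ) ⊗ₖ A).mulVec (ket (s, y)) =
      if s = t then ∑ z, A z y • ket (s, z) else 0 := by
    intro A t
    rw [mulVec_ket_eq_sum, Fintype.sum_prod_type, Finset.sum_eq_single s]
    · split_ifs with hs
      · simp [hs]
      · simp [Ne.symm hs]
    · intro b _ hb
      by_cases hs : t = s
      · have : t ≠ b := fun h => hb (h.symm.trans hs)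
        simp [this]
      · simp [hs]
    · simp
  rw [qubitControl, Matrix.add_mulVec, h, h]
  fin_cases s
  · simp [Matrix.one_apply]
  · simp

theorem qubitControl_permOp_mulVec_ket {Y : Type} [Fintype Y] [DecidableEq Y] (σ : Equiv.Perm Y)
    (s : Fin 2) (y : Y) : (qubitControl (permOp σ)).mulVec (ket (s, y)) =
      ket (s, if s = 0 then y else σ y) := by
  rw [qubitControl_mulVec_ket]
  split_ifs
  · rfl
  · simp [permOp]

theorem youngSite_fst {n m : ℕ} (r : ℕ) (h : m < n + 2) : ((youngSite n m r).1 : ℕ) = m :=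
  Nat.mod_eq_of_lt h

theorem youngSite_snd {n r : ℕ} (m : ℕ) (h : r < n + 2) : ((youngSite n m r).2 : ℕ) = r :=
  Nat.mod_eq_of_lt h

theorem addOne_ofNat (n m : ℕ) : addOne n (Fin.ofNat (n + 2) m) = Fin.ofNat (n + 2) (m + 1) := by
  ext
  simp [addOne, Fin.val_add]

theorem addOne_prodCongr_youngSite (n m r : ℕ) :
    (addOne n).prodCongr (Equiv.refl _) (youngSite n m r) = youngSite n (m + 1) r :=
  Prod.ext (addOne_ofNat n m) rfl

theorem prodCongr_addOne_youngSite (n m r : ℕ) :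
    (Equiv.refl _).prodCongr (addOne n) (youngSite n m r) = youngSite n m (r + 1) :=
  Prod.ext rfl (addOne_ofNat n r)

/-- The three factors add the incoming bit to the number of ones, rotate the bit by an angle that
depends on the site, and add the rotated bit to the second-row length. The outgoing bit thus records
the row of the new box. -/
theorem clebschGordan_mulVec_ket {n k : ℕ} (s : Fin 2) (m r : ℕ) (hm : m + s < n + 2)
    (hr : r < n + 2) {a b : ℕ} (ha : m + s - r = a) (hb : k + 1 - r - (m + s) = b)
    (hab : a + b ≠ 0) :
    (clebschGordan n k).mulVec (ket (s, youngSite n m r)) =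
      ((if s = 0 then natSqrt b else natSqrt a) / natSqrt (a + b)) •
        ket (0, youngSite n (m + s) r) +
      ((if s = 0 then -natSqrt a else natSqrt b) / natSqrt (a + b)) •
        ket (1, youngSite n (m + s) (r + 1)) := by
  have h1 : (if s = 0 then youngSite n m r else
      (addOne n).prodCongr (Equiv.refl _) (youngSite n m r)) = youngSite n (m + s) r := by
    rw [addOne_prodCongr_youngSite]
    fin_cases s <;> simp
  rw [clebschGordan, ← Matrix.mulVec_mulVec, ← Matrix.mulVec_mulVec,
    qubitControl_permOp_mulVec_ket, h1, mulVec_ket_eq_sum, sum_blockDiagonal_smul,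
    youngSite_fst _ hm, youngSite_snd _ hr, ha, hb, Fin.sum_univ_two, Matrix.mulVec_add,
    Matrix.mulVec_smul, Matrix.mulVec_smul, qubitControl_permOp_mulVec_ket,
    qubitControl_permOp_mulVec_ket, if_pos rfl, if_neg one_ne_zero, prodCongr_addOne_youngSite,
    couplingRotation, if_neg hab]
  fin_cases s <;> simp [div_eq_inv_mul]

/-- The coordinates `w = m - r` and `e = k - r - m` count the steps down and up the weight ladder,
and `d = w + e + 1` is its number of rungs. They replace truncated subtractions by sums. -/
theorem clebschGordan_mulVec_ket_zero {n k m r w e d : ℕ} (hkn : k < n) (hm : m = r + w)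
    (hk : k = 2 * r + w + e) (hd : d = w + e + 1) :
    (clebschGordan n k).mulVec (ket (0, youngSite n m r)) =
      (natSqrt (e + 1) / natSqrt d) • ket (0, youngSite n m r) -
        (natSqrt w / natSqrt d) • ket (1, youngSite n m (r + 1)) := by
  rw [clebschGordan_mulVec_ket 0 m r (a := w) (b := e + 1) (by simp; omega) (by omega)
    (by simp; omega) (by simp; omega) (by omega), if_pos rfl, if_pos rfl,
    show w + (e + 1) = d by omega, neg_div, neg_smul, sub_eq_add_neg]
  rfl

theorem clebschGordan_mulVec_ket_one {n k m r w e d : ℕ} (hkn : k < n) (hm : m = r + w)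
    (hk : k = 2 * r + w + e) (hd : d = w + e + 1) :
    (clebschGordan n k).mulVec (ket (1, youngSite n m r)) =
      (natSqrt (w + 1) / natSqrt d) • ket (0, youngSite n (m + 1) r) +
        (natSqrt e / natSqrt d) • ket (1, youngSite n (m + 1) (r + 1)) := by
  rw [clebschGordan_mulVec_ket 1 m r (a := w + 1) (b := e) (by simp; omega) (by omega)
    (by simp; omega) (by simp; omega) (by omega), if_neg one_ne_zero, if_neg one_ne_zero,
    show w + 1 + e = d by omega]
  rfl

theorem lowering_mulVec_ket {n k m r w e : ℕ} (hm : m = r + w) (hk : k = 2 * r + w + e)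
    (hkn : k ≤ n) : (Matrix.blockDiagonal (lowering n k)).mulVec (ket (youngSite n m r)) =
      (natSqrt w * natSqrt (e + 1)) • ket (youngSite n (m - 1) r) := by
  have hmn : m < n + 2 := by omega
  have hrn : r < n + 2 := by omega
  have hcoef : ∀ m', lowering n k (youngSite n m r).2 m' (youngSite n m r).1 =
      if (m' : ℕ) + 1 = m then natSqrt w * natSqrt (e + 1) else 0 := by
    intro m'
    rw [lowering, Matrix.of_apply, youngSite_fst _ hmn, youngSite_snd _ hrn]
    have h1 : m - r = w := by omega
    have h2 : k + 1 - r - m = e + 1 := by omega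
    rw [h1, h2]
  rw [mulVec_ket_eq_sum]
  refine (sum_blockDiagonal_smul (lowering n k) (youngSite n m r).1 (youngSite n m r).2 _).trans ?_
  simp only [hcoef]
  -- At `m = 0` the site `m - 1` is a junk value, but the coefficient vanishes.
  rcases Nat.eq_zero_or_pos m with rfl | hpos
  · have hw : w = 0 := by omega
    simp [hw, natSqrt_zero]
  · rw [Finset.sum_eq_single (Fin.ofNat (n + 2) (m - 1))]
    · rw [Fin.val_ofNat, Nat.mod_eq_of_lt (by omega), if_pos (by omega)]
      rfl
    · intro b _ hb
      rw [if_neg, zero_smul]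
      intro h
      refine hb (Fin.ext ?_)
      rw [Fin.val_ofNat, Nat.mod_eq_of_lt (by omega)]
      omega
    · simp

/-- Here `m + 1` can be as large as `n + 1`, which is why coordinates range over `Fin (n + 2)`: no
index wraps around, even where the coefficient is zero. -/
theorem raising_mulVec_ket {n k m r w e : ℕ} (hm : m = r + w) (hk : k = 2 * r + w + e)
    (hkn : k ≤ n) :
    (Matrix.blockDiagonal fun s => (lowering n k s).conjTranspose).mulVec
        (ket (youngSite n m r)) =
      (natSqrt (w + 1) * natSqrt e) • ket (youngSite n (m + 1) r) := by
  have hmn : m < n + 2 := by omega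
  have hrn : r < n + 2 := by omega
  have hcoef : ∀ m' : Fin (n + 2), (lowering n k (youngSite n m r).2).conjTranspose m'
      (youngSite n m r).1 =
      if m + 1 = (m' : ℕ) then natSqrt (w + 1) * natSqrt e else 0 := by
    intro m'
    rw [Matrix.conjTranspose_apply, lowering, Matrix.of_apply, youngSite_fst _ hmn,
      youngSite_snd _ hrn]
    split_ifs with h
    · have h1 : (m' : ℕ) - r = w + 1 := by omega
      have h2 : k + 1 - r - m' = e := by omega
      rw [h1, h2, star_mul', star_natSqrt, star_natSqrt]
    · exact star_zero ℂ
  rw [mulVec_ket_eq_sum]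
  refine (sum_blockDiagonal_smul (fun s => (lowering n k s).conjTranspose) (youngSite n m r).1
    (youngSite n m r).2 _).trans ?_
  simp only [hcoef]
  rw [Finset.sum_eq_single (Fin.ofNat (n + 2) (m + 1))]
  · rw [Fin.val_ofNat, Nat.mod_eq_of_lt (by omega), if_pos rfl]
    rfl
  · intro b _ hb
    rw [if_neg, zero_smul]
    intro h
    refine hb (Fin.ext ?_)
    rw [Fin.val_ofNat, Nat.mod_eq_of_lt (by omega)]
    omega
  · simp

/-- The sites that occur after `k` qubits have been coupled. -/
def ValidSite (n k : ℕ) (y : YoungSite n) : Prop :=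
  ∃ r w e, y = youngSite n (r + w) r ∧ k = 2 * r + w + e

/-- A family of operators on the sites that describes the collective operator `∑ σᵢ` of the qubits
coupled so far. -/
def IsCoupledBy (n : ℕ) (σ : Matrix (Fin 2) (Fin 2) ℂ)
    (S : ℕ → Matrix (YoungSite n) (YoungSite n) ℂ) : Prop :=
  (S 0).mulVec (ket (youngSite n 0 0)) = 0 ∧ ∀ k < n, ∀ s y, ValidSite n k y →
    (clebschGordan n k * ((1 : Matrix (Fin 2) (Fin 2) ℂ) ⊗ₖ S k + σ ⊗ₖ 1)).mulVec (ket (s, y)) =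
      (((1 : Matrix (Fin 2) (Fin 2) ℂ) ⊗ₖ S (k + 1)) * clebschGordan n k).mulVec (ket (s, y))

theorem one_kronecker_mulVec_ket_of_eq {X Y : Type*} [Fintype X] [DecidableEq X] [Fintype Y]
    [DecidableEq Y] {A : Matrix Y Y ℂ} {y z : Y} {c : ℂ} (h : A.mulVec (ket y) = c • ket z)
    (x : X) : ((1 : Matrix X X ℂ) ⊗ₖ A).mulVec (ket (x, y)) = c • ket (x, z) := by
  have hA : ∀ w, A w y = if w = z then c else 0 := by
    intro w
    have := congrFun h w
    rw [mulVec_ket_apply, Pi.smul_apply, ket_apply] at this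
    simpa using this
  rw [one_kronecker_mulVec_ket]
  simp [hA]

theorem lowering_mulVec_pair {n k m r w e : ℕ} (s : Fin 2) (hkn : k ≤ n) (hm : m = r + w)
    (hk : k = 2 * r + w + e) :
    ((1 : Matrix (Fin 2) (Fin 2) ℂ) ⊗ₖ Matrix.blockDiagonal (lowering n k)).mulVec
        (ket (s, youngSite n m r)) =
      (natSqrt w * natSqrt (e + 1)) • ket (s, youngSite n (m - 1) r) :=
  one_kronecker_mulVec_ket_of_eq (lowering_mulVec_ket hm hk hkn) s

theorem raising_mulVec_pair {n k m r w e : ℕ} (s : Fin 2) (hkn : k ≤ n) (hm : m = r + w)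
    (hk : k = 2 * r + w + e) :
    ((1 : Matrix (Fin 2) (Fin 2) ℂ) ⊗ₖ
      Matrix.blockDiagonal fun q => (lowering n k q).conjTranspose).mulVec
        (ket (s, youngSite n m r)) =
      (natSqrt (w + 1) * natSqrt e) • ket (s, youngSite n (m + 1) r) :=
  one_kronecker_mulVec_ket_of_eq (raising_mulVec_ket hm hk hkn) s

theorem single_kronecker_one_mulVec_ket {X Y : Type*} [Fintype X] [DecidableEq X] [Fintype Y]
    [DecidableEq Y] (i j s : X) (y : Y) :
    (Matrix.single i j (1 : ℂ) ⊗ₖ (1 : Matrix Y Y ℂ)).mulVec (ket (s, y)) =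
      if s = j then ket (i, y) else 0 := by
  rw [kronecker_one_mulVec_ket]
  split_ifs with h
  · rw [Finset.sum_eq_single i]
    · simp [h]
    · intro b _ hb
      simp [hb.symm]
    · simp
  · simp [Ne.symm h]

/-- This is the recursion of the Clebsch-Gordan coefficients: after comparing coefficients of basis
vectors, what remains is that the squares of consecutive `natSqrt` differ by one. -/
theorem lowering_isCoupled (n : ℕ) :
    IsCoupledBy n (Matrix.single 0 1 1) fun k => Matrix.blockDiagonal (lowering n k) := by
  refine ⟨?_, ?_⟩
  · refine (lowering_mulVec_ket (w := 0) (e := 0) (zero_add 0).symm rfl (Nat.zero_le n)).trans ?_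
    rw [natSqrt_zero, zero_mul, zero_smul]
  rintro k hk s _ ⟨r, w, e, rfl, hke⟩
  rw [← Matrix.mulVec_mulVec, ← Matrix.mulVec_mulVec, Matrix.add_mulVec,
    single_kronecker_one_mulVec_ket, lowering_mulVec_pair s hk.le rfl hke, Matrix.mulVec_add,
    Matrix.mulVec_smul]
  obtain ⟨d, hd⟩ : ∃ d, d = w + e + 1 := ⟨_, rfl⟩
  rcases (show s = 0 ∨ s = 1 by omega) with rfl | rfl
  · rw [if_neg zero_ne_one, Matrix.mulVec_zero, add_zero, clebschGordan_mulVec_ket_zero hk rfl hke hd,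
      Matrix.mulVec_sub, Matrix.mulVec_smul, Matrix.mulVec_smul,
      lowering_mulVec_pair (w := w) (e := e + 1) 0 hk rfl (by omega)]
    -- At the bottom of the ladder the lowered site is not valid and the coupling formula does not
    -- apply there; the factor `natSqrt w` is zero.
    rcases w with _ | w
    · simp [natSqrt_zero]
    · rw [clebschGordan_mulVec_ket_zero (w := w) (e := e + 1) hk (by omega) (by omega)
        (hd.trans (by omega)), lowering_mulVec_pair (w := w) (e := e) 1 hk (by omega) (by omega)]
      module
  · rw [if_pos rfl, clebschGordan_mulVec_ket_one hk rfl hke hd, Matrix.mulVec_add,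
      Matrix.mulVec_smul, Matrix.mulVec_smul,
      lowering_mulVec_pair (w := w + 1) (e := e) 0 hk (by omega) (by omega),
      clebschGordan_mulVec_ket_zero hk rfl hke hd]
    have h1 : natSqrt (w + 1) * natSqrt (w + 1) = natSqrt w * natSqrt w + 1 := by
      rw [natSqrt_mul_self, natSqrt_mul_self, Nat.cast_succ]
    have h2 : natSqrt (e + 1) * natSqrt (e + 1) = natSqrt e * natSqrt e + 1 := by
      rw [natSqrt_mul_self, natSqrt_mul_self, Nat.cast_succ]
    -- For `e = 0` this site is not valid after the coupling. Keeping the factor `natSqrt e` makes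
    -- the formula hold in that case too.
    have hlow : natSqrt e • ((1 : Matrix (Fin 2) (Fin 2) ℂ) ⊗ₖ
        Matrix.blockDiagonal (lowering n (k + 1))).mulVec (ket (1, youngSite n (r + w + 1) (r + 1))) =
        (natSqrt w * (natSqrt e * natSqrt e)) • ket (1, youngSite n (r + w) (r + 1)) := by
      rcases e with _ | e
      · simp [natSqrt_zero]
      · rw [lowering_mulVec_pair (w := w) (e := e) 1 hk (by omega) (by omega), smul_smul,
          Nat.add_sub_cancel]
        congr 1
        ring
    rw [div_eq_inv_mul (natSqrt e), mul_smul _ (natSqrt e), hlow, Nat.add_sub_cancel]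
    rcases w with _ | w
    · simp only [natSqrt_zero, zero_mul, zero_smul, smul_zero, zero_add, mul_zero,
        zero_div, sub_zero, add_zero] at h1 ⊢
      rw [smul_smul]
      congr 1
      linear_combination (-natSqrt (e + 1) / natSqrt d) * h1
    · rw [clebschGordan_mulVec_ket_one (w := w) (e := e + 1) hk (by omega) (by omega)
        (hd.trans (by omega)), show r + (w + 1) - 1 + 1 = r + (w + 1) by omega]
      match_scalars
      · linear_combination (-natSqrt (e + 1) / natSqrt d) * h1
      · linear_combination (natSqrt (w + 1) / natSqrt d) * h2

/-- The mirror image of the lowering case, with `w` and `e` exchanged. -/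
theorem raising_isCoupled (n : ℕ) :
    IsCoupledBy n (Matrix.single 1 0 1) fun k =>
      Matrix.blockDiagonal fun q => (lowering n k q).conjTranspose := by
  refine ⟨?_, ?_⟩
  · refine (raising_mulVec_ket (w := 0) (e := 0) (zero_add 0).symm rfl (Nat.zero_le n)).trans ?_
    rw [natSqrt_zero, mul_zero, zero_smul]
  rintro k hk s _ ⟨r, w, e, rfl, hke⟩
  rw [← Matrix.mulVec_mulVec, ← Matrix.mulVec_mulVec, Matrix.add_mulVec,
    single_kronecker_one_mulVec_ket, raising_mulVec_pair s hk.le rfl hke, Matrix.mulVec_add,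
    Matrix.mulVec_smul]
  obtain ⟨d, hd⟩ : ∃ d, d = w + e + 1 := ⟨_, rfl⟩
  rcases (show s = 0 ∨ s = 1 by omega) with rfl | rfl
  · rw [if_pos rfl, clebschGordan_mulVec_ket_zero hk rfl hke hd, Matrix.mulVec_sub,
      Matrix.mulVec_smul, Matrix.mulVec_smul,
      raising_mulVec_pair (w := w) (e := e + 1) 0 hk (by omega) (by omega),
      clebschGordan_mulVec_ket_one hk rfl hke hd]
    have h1 : natSqrt (w + 1) * natSqrt (w + 1) = natSqrt w * natSqrt w + 1 := by
      rw [natSqrt_mul_self, natSqrt_mul_self, Nat.cast_succ]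
    have h2 : natSqrt (e + 1) * natSqrt (e + 1) = natSqrt e * natSqrt e + 1 := by
      rw [natSqrt_mul_self, natSqrt_mul_self, Nat.cast_succ]
    have hraise : natSqrt w • ((1 : Matrix (Fin 2) (Fin 2) ℂ) ⊗ₖ
        Matrix.blockDiagonal fun q => (lowering n (k + 1) q).conjTranspose).mulVec
          (ket (1, youngSite n (r + w) (r + 1))) =
        (natSqrt w * natSqrt w * natSqrt e) • ket (1, youngSite n (r + w + 1) (r + 1)) := by
      rcases w with _ | w
      · simp [natSqrt_zero]
      · rw [raising_mulVec_pair (w := w) (e := e) 1 hk (by omega) (by omega), smul_smul]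
        congr 1
        ring
    rw [div_eq_inv_mul (natSqrt w), mul_smul _ (natSqrt w), hraise]
    rcases e with _ | e
    · simp only [natSqrt_zero, zero_smul, mul_zero, smul_zero, zero_add,
        zero_div, sub_zero, add_zero] at h2 ⊢
      rw [smul_smul]
      congr 1
      linear_combination (-natSqrt (w + 1) / natSqrt d) * h2
    · rw [clebschGordan_mulVec_ket_zero (w := w + 1) (e := e) hk (by omega) (by omega)
        (hd.trans (by omega))]
      match_scalars
      · linear_combination (-natSqrt (w + 1) / natSqrt d) * h2
      · linear_combination (-natSqrt (e + 1) / natSqrt d) * h1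
  · rw [if_neg one_ne_zero, Matrix.mulVec_zero, add_zero, clebschGordan_mulVec_ket_one hk rfl hke hd,
      Matrix.mulVec_add, Matrix.mulVec_smul, Matrix.mulVec_smul,
      raising_mulVec_pair (w := w + 1) (e := e) 0 hk (by omega) (by omega)]
    rcases e with _ | e
    · simp [natSqrt_zero]
    · rw [clebschGordan_mulVec_ket_one (w := w + 1) (e := e) hk (by omega) (by omega)
        (hd.trans (by omega)), raising_mulVec_pair (w := w) (e := e) 1 hk (by omega) (by omega)]
      module

/-- A box in the second row would leave the valid sites only at `w = 0` (incoming bit 0) or `e = 0`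
(incoming bit 1), and there its amplitude is zero. -/
theorem clebschGordan_validSite {n k : ℕ} (hk : k < n) {s : Fin 2} {y : YoungSite n}
    (hy : ValidSite n k y) {c : Fin 2 × YoungSite n} (hc : clebschGordan n k c (s, y) ≠ 0) :
    ValidSite n (k + 1) c.2 := by
  obtain ⟨r, w, e, rfl, hke⟩ := hy
  rw [← mulVec_ket_apply (clebschGordan n k)] at hc
  rcases (show s = 0 ∨ s = 1 by omega) with rfl | rfl
  · rw [clebschGordan_mulVec_ket_zero hk rfl hke rfl, Pi.sub_apply, Pi.smul_apply, Pi.smul_apply,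
      ket_apply, ket_apply] at hc
    by_cases h0 : c = (0, youngSite n (r + w) r)
    · exact ⟨r, w, e + 1, by rw [h0], by omega⟩
    by_cases h1 : c = (1, youngSite n (r + w) (r + 1))
    · rcases w with _ | w
      · rw [h1] at hc
        simp [natSqrt_zero] at hc
      · exact ⟨r + 1, w, e, by rw [h1, show r + 1 + w = r + (w + 1) by omega], by omega⟩
    · simp [h0, h1] at hc
  · rw [clebschGordan_mulVec_ket_one hk rfl hke rfl, Pi.add_apply, Pi.smul_apply, Pi.smul_apply,
      ket_apply, ket_apply] at hc
    by_cases h0 : c = (0, youngSite n (r + w + 1) r)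
    · exact ⟨r, w + 1, e, by rw [h0]; rfl, by omega⟩
    by_cases h1 : c = (1, youngSite n (r + w + 1) (r + 1))
    · rcases e with _ | e
      · rw [h1] at hc
        simp [natSqrt_zero] at hc
      · exact ⟨r + 1, w, e, by rw [h1, show r + 1 + w = r + w + 1 by omega], by omega⟩
    · simp [h0, h1] at hc

/-! ### Coupling the qubits one at a time -/

theorem atQubit_mulVec_ket_congr {n : ℕ} {Y : Type} [Fintype Y] [DecidableEq Y] (k : Fin n)
    {A B : Matrix (Fin 2 × Y) (Fin 2 × Y) ℂ} {y : Y}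
    (h : ∀ s, A.mulVec (ket (s, y)) = B.mulVec (ket (s, y))) (x : Fin n → Fin 2) :
    (atQubit k A).mulVec (ket (x, y)) = (atQubit k B).mulVec (ket (x, y)) := by
  rw [atQubit_mulVec_ket, atQubit_mulVec_ket]
  refine Finset.sum_congr rfl fun c _ => ?_
  rw [← mulVec_ket_apply A, h, mulVec_ket_apply]

theorem siteOp_kronecker_one {n : ℕ} {Y : Type} [Fintype Y] [DecidableEq Y] (i : Fin n)
    (σ : Matrix (Fin 2) (Fin 2) ℂ) :
    siteOp i σ ⊗ₖ (1 : Matrix Y Y ℂ) = atQubit i (σ ⊗ₖ 1) := by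
  ext l l'
  simp only [Matrix.kroneckerMap_apply, siteOp_apply, atQubit, Matrix.of_apply]
  split_ifs <;> simp

theorem atQubit_comm {n : ℕ} {Y : Type} [Fintype Y] [DecidableEq Y] {i k : Fin n} (h : i ≠ k)
    (σ : Matrix (Fin 2) (Fin 2) ℂ) (A : Matrix (Fin 2 × Y) (Fin 2 × Y) ℂ) :
    atQubit k A * (siteOp i σ ⊗ₖ (1 : Matrix Y Y ℂ)) =
      (siteOp i σ ⊗ₖ (1 : Matrix Y Y ℂ)) * atQubit k A := by
  have hσ : ∀ (x : Fin n → Fin 2) (y : Y), (atQubit i (σ ⊗ₖ (1 : Matrix Y Y ℂ))).mulVec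
      (ket (x, y)) = ∑ z, σ z (x i) • ket (Function.update x i z, y) := by
    intro x y
    rw [atQubit_mulVec_ket, Fintype.sum_prod_type]
    refine Finset.sum_congr rfl fun z _ => ?_
    rw [Finset.sum_eq_single y]
    · simp
    · intro b _ hb
      simp [Matrix.one_apply_ne hb]
    · simp
  refine Matrix.ext_of_mulVec_ket ?_
  rintro ⟨x, y⟩
  rw [siteOp_kronecker_one, ← Matrix.mulVec_mulVec, ← Matrix.mulVec_mulVec, hσ, atQubit_mulVec_ket,
    Matrix.mulVec_sum, Matrix.mulVec_sum]
  simp only [Matrix.mulVec_smul, hσ, atQubit_mulVec_ket, Finset.smul_sum, smul_smul,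
    Function.update_of_ne h, Function.update_of_ne h.symm]
  rw [Finset.sum_comm]
  refine Finset.sum_congr rfl fun c _ => Finset.sum_congr rfl fun z _ => ?_
  rw [mul_comm, Function.update_comm h]

theorem kronecker_one_sum {X Y ι : Type*} [DecidableEq Y] (s : Finset ι)
    (A : ι → Matrix X X ℂ) :
    (∑ i ∈ s, A i) ⊗ₖ (1 : Matrix Y Y ℂ) = ∑ i ∈ s, A i ⊗ₖ (1 : Matrix Y Y ℂ) := by
  ext l l'
  simp [Matrix.sum_apply, Finset.sum_mul]

/-- The collective operator after `k` of the qubits have been coupled. -/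
def partlyCoupled {n : ℕ} (σ : Matrix (Fin 2) (Fin 2) ℂ)
    (S : ℕ → Matrix (YoungSite n) (YoungSite n) ℂ) (k : ℕ) :
    Matrix ((Fin n → Fin 2) × YoungSite n) ((Fin n → Fin 2) × YoungSite n) ℂ :=
  (1 : QOp (Fin n)) ⊗ₖ S k +
    ∑ i : Fin n with k ≤ i.val, siteOp i σ ⊗ₖ
      (1 : Matrix (YoungSite n) (YoungSite n) ℂ)

/-- Qubit `k` is split off from the uncoupled ones. The rest commute with the coupling, and the
coupling relation absorbs qubit `k` into the site operator. -/
theorem IsCoupledBy.step {n : ℕ} {σ : Matrix (Fin 2) (Fin 2) ℂ}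
    {S : ℕ → Matrix (YoungSite n) (YoungSite n) ℂ} (hS : IsCoupledBy n σ S) (k : Fin n)
    {y : YoungSite n} (hy : ValidSite n k y) (x : Fin n → Fin 2) :
    (atQubit k (clebschGordan n k) * partlyCoupled σ S k).mulVec (ket (x, y)) =
      (partlyCoupled σ S (k + 1) * atQubit k (clebschGordan n k)).mulVec (ket (x, y)) := by
  have hsplit : (Finset.univ.filter fun i : Fin n => (k : ℕ) ≤ i.val) =
      insert k (Finset.univ.filter fun i : Fin n => (k : ℕ) + 1 ≤ i.val) := by
    ext i
    simp only [Finset.mem_filter, Finset.mem_univ, true_and, Finset.mem_insert, Fin.ext_iff]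
    omega
  have hcomm : atQubit k (clebschGordan n k) *
      ∑ i : Fin n with (k : ℕ) + 1 ≤ i.val, siteOp i σ ⊗ₖ
      (1 : Matrix (YoungSite n) (YoungSite n) ℂ) =
      (∑ i : Fin n with (k : ℕ) + 1 ≤ i.val, siteOp i σ ⊗ₖ
      (1 : Matrix (YoungSite n) (YoungSite n) ℂ)) *
        atQubit k (clebschGordan n k) := by
    rw [Finset.mul_sum, Finset.sum_mul]
    refine Finset.sum_congr rfl fun i hi => atQubit_comm ?_ _ _
    rintro rfl
    simp at hi
  rw [partlyCoupled, partlyCoupled, hsplit, Finset.sum_insert (by simp), ← add_assoc,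
    siteOp_kronecker_one, ← atQubit_one_kronecker k (S k), ← atQubit_add, mul_add, add_mul, hcomm,
    ← atQubit_mul, ← atQubit_one_kronecker k (S (k + 1)), ← atQubit_mul, Matrix.add_mulVec,
    Matrix.add_mulVec, atQubit_mulVec_ket_congr k (fun s => hS.2 k k.2 s y hy)]

/-- The coupling relations hold only at valid sites; this applies them to vectors supported there.
-/
theorem mulVec_eq_of_forall_ket {K L : Type*} [Fintype L] [DecidableEq L] {A B : Matrix K L ℂ}
    {v : L → ℂ} (h : ∀ l, v l ≠ 0 → A.mulVec (ket l) = B.mulVec (ket l)) :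
    A.mulVec v = B.mulVec v := by
  ext k
  refine Finset.sum_congr rfl fun l _ => ?_
  by_cases hl : v l = 0
  · simp [hl]
  · have hAB := congrFun (h l hl) k
    rw [mulVec_ket_apply, mulVec_ket_apply] at hAB
    exact congrArg (· * v l) hAB

/-- The Schur transform of the first `k` qubits. -/
noncomputable def schur (n : ℕ) :
    ℕ → Matrix ((Fin n → Fin 2) × YoungSite n) ((Fin n → Fin 2) × YoungSite n) ℂ
  | 0 => 1
  | k + 1 => if h : k < n then atQubit ⟨k, h⟩ (clebschGordan n k) * schur n k else schur n k

theorem schur_validSite {n k : ℕ} (hk : k ≤ n) {v : (Fin n → Fin 2) × YoungSite n → ℂ}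
    (hv : ∀ l, v l ≠ 0 → l.2 = youngSite n 0 0) {l : (Fin n → Fin 2) × YoungSite n}
    (hl : (schur n k).mulVec v l ≠ 0) : ValidSite n k l.2 := by
  induction k generalizing l with
  | zero =>
    rw [schur, Matrix.one_mulVec] at hl
    exact ⟨0, 0, 0, hv l hl, rfl⟩
  | succ k ih =>
    rw [schur, dif_pos (Nat.lt_of_succ_le hk), ← Matrix.mulVec_mulVec] at hl
    obtain ⟨l', -, hl'⟩ := Finset.exists_ne_zero_of_sum_ne_zero hl
    have h := ih (Nat.le_of_succ_le hk) (right_ne_zero_of_mul hl')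
    have h2 := left_ne_zero_of_mul hl'
    simp only [atQubit, Matrix.of_apply] at h2
    split_ifs at h2
    · exact clebschGordan_validSite hk h h2
    · exact absurd rfl h2

/-- At `k = 0` the site operator annihilates the origin, so the partly coupled operator acts as the
bare collective one. Validity of the sites propagates along the induction. -/
theorem IsCoupledBy.schur {n : ℕ} {σ : Matrix (Fin 2) (Fin 2) ℂ}
    {S : ℕ → Matrix (YoungSite n) (YoungSite n) ℂ} (hS : IsCoupledBy n σ S) {k : ℕ} (hk : k ≤ n)
    {v : (Fin n → Fin 2) × YoungSite n → ℂ} (hv : ∀ l, v l ≠ 0 → l.2 = youngSite n 0 0) :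
    (schur n k).mulVec ((collective σ ⊗ₖ (1 : Matrix (YoungSite n) (YoungSite n) ℂ)).mulVec v) =
      (partlyCoupled σ S k).mulVec ((schur n k).mulVec v) := by
  induction k with
  | zero =>
    simp only [_root_.schur, Matrix.one_mulVec, partlyCoupled, Nat.zero_le, Finset.filter_true,
      Matrix.add_mulVec, ← kronecker_one_sum, ← collective_apply]
    have : ((1 : QOp (Fin n)) ⊗ₖ S 0).mulVec v =
        (0 : Matrix _ ((Fin n → Fin 2) × YoungSite n) ℂ).mulVec v := by
      refine mulVec_eq_of_forall_ket fun l hl => ?_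
      obtain ⟨x, y⟩ := l
      obtain rfl : y = youngSite n 0 0 := hv _ hl
      rw [one_kronecker_mulVec_ket_of_eq (z := youngSite n 0 0) (c := 0) (by rw [hS.1, zero_smul]),
        zero_smul, Matrix.zero_mulVec]
    rw [this, Matrix.zero_mulVec, zero_add]
  | succ k ih =>
    rw [_root_.schur, dif_pos (Nat.lt_of_succ_le hk), ← Matrix.mulVec_mulVec, ← Matrix.mulVec_mulVec,
      ih (Nat.le_of_succ_le hk)]
    refine (Matrix.mulVec_mulVec _ _ _).trans (Eq.trans ?_ (Matrix.mulVec_mulVec _ _ _).symm)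
    refine mulVec_eq_of_forall_ket fun l hl => ?_
    exact hS.step ⟨k, hk⟩ (schur_validSite (Nat.le_of_succ_le hk) hv hl) l.1

theorem schur_implementable {n a : ℕ} {f : YoungSite n → Fin a} (hf : Function.Injective f)
    (k : ℕ) : Implementable f (schur n k) (k * (7 * (n + 2) ^ 2)) := by
  induction k with
  | zero => exact Implementable.one.mono (Nat.zero_le _)
  | succ k ih =>
    rw [schur]
    split_ifs with h
    · have hcard : Fintype.card (YoungSite n) = (n + 2) ^ 2 := by
        rw [Fintype.card_prod, Fintype.card_fin, sq]
      -- Two controlled permutations at three gates per site and one site-dependent rotation at one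
      -- gate per site: seven per site.
      have h1 := (((Implementable.controlPerm hf ⟨k, h⟩
        ((Equiv.refl _).prodCongr (addOne n))).mul (Implementable.controlAll hf ⟨k, h⟩
          (g := fun y : YoungSite n => couplingRotation ((y.1 : ℕ) - y.2) (k + 1 - y.2 - y.1))
          fun _ => couplingRotation_mem_unitary _ _)).mul (Implementable.controlPerm hf ⟨k, h⟩
        ((addOne n).prodCongr (Equiv.refl _)))).mul ih
      rw [← atQubit_mul, ← atQubit_mul, hcard] at h1
      exact h1.mono (by ring_nf; omega)
    · exact ih.mono (Nat.mul_le_mul_right _ (Nat.le_succ k))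

/-- The states of the qubits, with the particle at the site of the empty Young diagram. -/
def atOrigin (n : ℕ) : Matrix ((Fin n → Fin 2) × YoungSite n) (Fin n → Fin 2) ℂ :=
  Matrix.of fun l x => if l = (x, youngSite n 0 0) then 1 else 0

theorem atOrigin_mulVec_ket {n : ℕ} (x : Fin n → Fin 2) :
    (atOrigin n).mulVec (ket x) = ket (x, youngSite n 0 0) := by
  ext l
  rw [mulVec_ket_apply, ket_apply, atOrigin, Matrix.of_apply]

/-- The Schur transform of all the qubits, as an isometry. -/
noncomputable def schurIsometry (n : ℕ) :
    Matrix ((Fin n → Fin 2) × YoungSite n) (Fin n → Fin 2) ℂ :=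
  schur n n * atOrigin n

theorem IsCoupledBy.schurIsometry {n : ℕ} {σ : Matrix (Fin 2) (Fin 2) ℂ}
    {S : ℕ → Matrix (YoungSite n) (YoungSite n) ℂ} (hS : IsCoupledBy n σ S) :
    schurIsometry n * (collective σ : QOp (Fin n)) =
      ((1 : QOp (Fin n)) ⊗ₖ S n) * schurIsometry n := by
  have hJ : atOrigin n * (collective σ : QOp (Fin n)) =
      ((collective σ : QOp (Fin n)) ⊗ₖ (1 : Matrix (YoungSite n) (YoungSite n) ℂ)) * atOrigin n := by
    refine Matrix.ext_of_mulVec_ket fun x => ?_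
    rw [← Matrix.mulVec_mulVec, ← Matrix.mulVec_mulVec, atOrigin_mulVec_ket,
      kronecker_one_mulVec_ket, mulVec_ket_eq_sum, Matrix.mulVec_sum]
    simp only [Matrix.mulVec_smul, atOrigin_mulVec_ket]
  have hX : partlyCoupled σ S n = (1 : QOp (Fin n)) ⊗ₖ S n := by
    rw [partlyCoupled, Finset.filter_false_of_mem (fun i _ => not_le.2 i.2), Finset.sum_empty,
      add_zero]
  rw [_root_.schurIsometry, Matrix.mul_assoc, hJ]
  refine Matrix.ext_of_mulVec_ket fun x => ?_
  rw [← Matrix.mulVec_mulVec, ← Matrix.mulVec_mulVec, ← Matrix.mulVec_mulVec,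
    ← Matrix.mulVec_mulVec, atOrigin_mulVec_ket, hS.schur le_rfl, hX]
  intro l hl
  rw [ket_apply] at hl
  split_ifs at hl with h
  · rw [h]
  · exact absurd rfl hl

/-! ### Permutation-invariant operators in the Schur basis -/

/-- The operator `A` becomes, in the Schur basis, the block diagonal operator with blocks `a`. -/
def HasBlocks {n : ℕ} (A : QOp (Fin n))
    (a : Fin (n + 2) → Matrix (Fin (n + 2)) (Fin (n + 2)) ℂ) : Prop :=
  schurIsometry n * A =
    ((1 : QOp (Fin n)) ⊗ₖ Matrix.blockDiagonal a) * schurIsometry n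

theorem HasBlocks.add {n : ℕ} {A B : QOp (Fin n)}
    {a b : Fin (n + 2) → Matrix (Fin (n + 2)) (Fin (n + 2)) ℂ} (hA : HasBlocks A a)
    (hB : HasBlocks B b) : HasBlocks (A + B) (a + b) := by
  rw [HasBlocks, Matrix.mul_add, hA, hB, Matrix.blockDiagonal_add, Matrix.kronecker_add,
    Matrix.add_mul]

theorem HasBlocks.mul {n : ℕ} {A B : QOp (Fin n)}
    {a b : Fin (n + 2) → Matrix (Fin (n + 2)) (Fin (n + 2)) ℂ} (hA : HasBlocks A a)
    (hB : HasBlocks B b) : HasBlocks (A * B) (a * b) := by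
  have h : Matrix.blockDiagonal (a * b) = Matrix.blockDiagonal a * Matrix.blockDiagonal b :=
    Matrix.blockDiagonal_mul a b
  rw [HasBlocks, ← Matrix.mul_assoc, hA, Matrix.mul_assoc, hB, ← Matrix.mul_assoc, h,
    one_kronecker_mul]

theorem HasBlocks.smul {n : ℕ} {A : QOp (Fin n)}
    {a : Fin (n + 2) → Matrix (Fin (n + 2)) (Fin (n + 2)) ℂ} (hA : HasBlocks A a) (c : ℂ) :
    HasBlocks (c • A) (c • a) := by
  rw [HasBlocks, Matrix.mul_smul, hA, Matrix.blockDiagonal_smul, Matrix.kronecker_smul,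
    Matrix.smul_mul]

theorem HasBlocks.one {n : ℕ} : HasBlocks (1 : QOp (Fin n)) 1 := by
  rw [HasBlocks, Matrix.blockDiagonal_one, Matrix.one_kronecker_one, Matrix.mul_one, Matrix.one_mul]

/-- The block form is closed under algebra operations and holds for the generators. The adjoint is
carried along because the two generators are adjoint to each other. -/
theorem exists_hasBlocks_of_mem_spinAlgebra {n : ℕ} {A : QOp (Fin n)} (hA : A ∈ spinAlgebra n) :
    ∃ a, HasBlocks A a ∧ HasBlocks A.conjTranspose (star a) := by
  have hstar : (collective (Matrix.single 0 1 1) : QOp (Fin n)).conjTranspose =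
      collective (Matrix.single 1 0 1) := by
    ext x y
    simp only [collective_apply, Matrix.conjTranspose_apply, Matrix.sum_apply, siteOp_apply,
      star_sum]
    refine Finset.sum_congr rfl fun i _ => ?_
    simp only [eq_comm (a := y _)]
    split_ifs
    · simp [Matrix.single_apply, and_comm]
    · simp
  have hlow : HasBlocks (collective (Matrix.single 0 1 1)) (lowering n n) :=
    (lowering_isCoupled n).schurIsometry
  have hraise : HasBlocks (collective (Matrix.single 1 0 1)) (star (lowering n n)) :=
    (raising_isCoupled n).schurIsometry
  induction hA using Algebra.adjoin_induction with
  | mem A hA =>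
    rcases hA with rfl | rfl
    · exact ⟨lowering n n, hlow, hstar ▸ hraise⟩
    · refine ⟨star (lowering n n), hraise, ?_⟩
      rw [star_star, ← hstar, Matrix.conjTranspose_conjTranspose]
      exact hlow
  | algebraMap c =>
    refine ⟨c • 1, ?_, ?_⟩
    · rw [Algebra.algebraMap_eq_smul_one]
      exact HasBlocks.one.smul c
    · rw [Algebra.algebraMap_eq_smul_one, Matrix.conjTranspose_smul, Matrix.conjTranspose_one,
        star_smul, star_one]
      exact HasBlocks.one.smul _
  | add A B _ _ hA hB =>
    obtain ⟨a, h1, h2⟩ := hA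
    obtain ⟨b, h3, h4⟩ := hB
    refine ⟨a + b, h1.add h3, ?_⟩
    rw [Matrix.conjTranspose_add, star_add]
    exact h2.add h4
  | mul A B _ _ hA hB =>
    obtain ⟨a, h1, h2⟩ := hA
    obtain ⟨b, h3, h4⟩ := hB
    refine ⟨a * b, h1.mul h3, ?_⟩
    rw [Matrix.conjTranspose_mul, star_mul]
    exact h4.mul h2

/-- The isometry need not be onto, so blocks of a Hermitian operator need not be Hermitian;
averaging them with their adjoints makes them so. -/
theorem exists_hermitian_hasBlocks {n : ℕ} {H : QOp (Fin n)} (hH : PermutationInvariant H)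
    (hherm : H.IsHermitian) : ∃ h, HasBlocks H h ∧ ∀ r, (h r).IsHermitian := by
  obtain ⟨a, h1, h2⟩ := exists_hasBlocks_of_mem_spinAlgebra (permutationInvariant_mem_spinAlgebra hH)
  rw [hherm.eq] at h2
  refine ⟨(2⁻¹ : ℂ) • (a + star a), ?_, fun r => ?_⟩
  · have := (h1.add h2).smul 2⁻¹
    rwa [← two_smul ℂ H, smul_smul, inv_mul_cancel₀ two_ne_zero, one_smul] at this
  · rw [Matrix.IsHermitian, Pi.smul_apply, Matrix.conjTranspose_smul, Pi.add_apply,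
      Matrix.conjTranspose_add, Pi.star_apply, Matrix.star_eq_conjTranspose,
      Matrix.conjTranspose_conjTranspose, add_comm (a r)]
    congr 1
    simp

/-! ### The evolution in the Schur basis -/

theorem exp_intertwine {K L : Type*} [Fintype K] [DecidableEq K] [Fintype L] [DecidableEq L]
    {T : Matrix K L ℂ} {A : Matrix L L ℂ} {B : Matrix K K ℂ} (h : T * A = B * T) :
    T * NormedSpace.exp A = NormedSpace.exp B * T := by
  have hpow : ∀ m : ℕ, T * A ^ m = B ^ m * T := by
    intro m
    induction m with
    | zero => simp
    | succ m ih => rw [pow_succ, ← Matrix.mul_assoc, ih, Matrix.mul_assoc, h, ← Matrix.mul_assoc,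
        pow_succ]
  -- Any algebra norm will do: it only serves the convergence of the exponential series, which is
  -- then compared term by term.
  let _ : NormedRing (Matrix L L ℂ) := Matrix.linftyOpNormedRing
  let _ : NormedAlgebra ℂ (Matrix L L ℂ) := Matrix.linftyOpNormedAlgebra
  let _ : NormedRing (Matrix K K ℂ) := Matrix.linftyOpNormedRing
  let _ : NormedAlgebra ℂ (Matrix K K ℂ) := Matrix.linftyOpNormedAlgebra
  have hA := NormedSpace.exp_series_hasSum_exp' (𝕂 := ℂ) A
  have hB := NormedSpace.exp_series_hasSum_exp' (𝕂 := ℂ) B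
  have h1 := hA.map (AddMonoidHom.mk' (fun M : Matrix L L ℂ => T * M) (Matrix.mul_add T))
    (continuous_const.matrix_mul continuous_id)
  have h2 := hB.map (AddMonoidHom.mk' (fun M : Matrix K K ℂ => M * T)
    (fun M N => Matrix.add_mul M N T)) (continuous_id.matrix_mul continuous_const)
  refine h1.unique ?_
  have h2' : HasSum (fun m : ℕ => ((m.factorial : ℂ)⁻¹ • B ^ m) * T) (NormedSpace.exp B * T) := h2
  have heq : (fun m : ℕ => T * ((m.factorial : ℂ)⁻¹ • A ^ m)) =
      fun m : ℕ => ((m.factorial : ℂ)⁻¹ • B ^ m) * T := by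
    ext1 m
    rw [Matrix.mul_smul, Matrix.smul_mul, hpow]
  rw [← heq] at h2'
  exact h2'

/-- For each `x`, tensoring with `ket x` intertwines `A` with its extension. -/
theorem exp_one_kronecker {X Y : Type*} [Fintype X] [DecidableEq X] [Fintype Y] [DecidableEq Y]
    (A : Matrix Y Y ℂ) :
    NormedSpace.exp ((1 : Matrix X X ℂ) ⊗ₖ A) = (1 : Matrix X X ℂ) ⊗ₖ NormedSpace.exp A := by
  refine Matrix.ext_of_mulVec_ket ?_
  rintro ⟨x, y⟩
  let T : Matrix (X × Y) Y ℂ := Matrix.of fun l z => if l = (x, z) then 1 else 0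
  have hT : ∀ z, T.mulVec (ket z) = ket (x, z) := by
    intro z
    ext l
    rw [mulVec_ket_apply, ket_apply]
    rfl
  have hTB : ∀ B : Matrix Y Y ℂ, T * B = ((1 : Matrix X X ℂ) ⊗ₖ B) * T := by
    intro B
    refine Matrix.ext_of_mulVec_ket fun z => ?_
    rw [← Matrix.mulVec_mulVec, ← Matrix.mulVec_mulVec, hT, one_kronecker_mulVec_ket,
      mulVec_ket_eq_sum, Matrix.mulVec_sum]
    simp only [Matrix.mulVec_smul, hT]
  have h := exp_intertwine (hTB A)
  rw [hTB] at h
  rw [← hT, Matrix.mulVec_mulVec, Matrix.mulVec_mulVec, h]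

theorem evolution_mem_unitary {Q : Type} [Fintype Q] [DecidableEq Q] {A : Matrix Q Q ℂ}
    (hA : A.IsHermitian) (t : ℝ) :
    NormedSpace.exp ((-(Complex.I * (t : ℂ))) • A) ∈ Matrix.unitaryGroup Q ℂ := by
  rw [Matrix.mem_unitaryGroup_iff, Matrix.star_eq_conjTranspose, ← Matrix.exp_conjTranspose,
    Matrix.conjTranspose_smul, hA.eq]
  have hs : star (-(Complex.I * (t : ℂ))) = Complex.I * t := by
    simp
  rw [hs, ← Matrix.exp_add_of_commute _ _ ((Commute.refl A).smul_left _ |>.smul_right _),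
    ← add_smul, neg_add_cancel, zero_smul, NormedSpace.exp_zero]

/-- In the Schur basis, the evolution under a permutation-invariant Hamiltonian is a block diagonal
unitary. -/
theorem exists_unitary_blocks_evolution {n : ℕ} {H : QOp (Fin n)} (hH : PermutationInvariant H)
    (hherm : H.IsHermitian) (t : ℝ) :
    ∃ u, HasBlocks (evolution H t) u ∧ ∀ r, u r ∈ Matrix.unitaryGroup (Fin (n + 2)) ℂ := by
  obtain ⟨h, hb, hh⟩ := exists_hermitian_hasBlocks hH hherm
  refine ⟨fun r => NormedSpace.exp ((-(Complex.I * (t : ℂ))) • h r), ?_,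
    fun r => evolution_mem_unitary (hh r) t⟩
  have h2 := exp_intertwine (hb.smul (-(Complex.I * (t : ℂ))))
  -- The exponential of a family, in the product of the matrix algebras, is taken block by block.
  have hexp : NormedSpace.exp ((-(Complex.I * (t : ℂ))) • h) =
      fun r => NormedSpace.exp ((-(Complex.I * (t : ℂ))) • h r) := by
    let _ : NormedRing (Matrix (Fin (n + 2)) (Fin (n + 2)) ℂ) := Matrix.linftyOpNormedRing
    let _ : NormedAlgebra ℚ (Matrix (Fin (n + 2)) (Fin (n + 2)) ℂ) := Matrix.linftyOpNormedAlgebra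
    let _ : NormedAlgebra ℂ (Matrix (Fin (n + 2)) (Fin (n + 2)) ℂ) := Matrix.linftyOpNormedAlgebra
    have hc : CompleteSpace (Matrix (Fin (n + 2)) (Fin (n + 2)) ℂ) := FiniteDimensional.complete ℂ _
    exact @Pi.exp_def _ (fun _ : Fin (n + 2) => Matrix (Fin (n + 2)) (Fin (n + 2)) ℂ) _ _ _
      (fun _ => hc) _
  rw [HasBlocks, evolution, h2, exp_one_kronecker, Matrix.exp_blockDiagonal, hexp]

/-! ### Simulating permutation-invariant Hamiltonians -/

theorem LocalHamiltonians.isHermitian {k : ℕ} {g : ℕ∞} {n : ℕ} {H : QOp (Fin n)}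
    (hH : H ∈ LocalHamiltonians k g n) : H.IsHermitian := by
  obtain ⟨h, hh, -, -, rfl⟩ := hH
  exact (Matrix.conjTranspose_sum _ _).trans (Finset.sum_congr rfl fun X _ => (hh X).1)

/-- The linear extension of `|x⟩ ↦ |x⟩ ⊗ |0…0⟩`. -/
def withZerosMatrix (n a : ℕ) : Matrix (Fin n ⊕ Fin a → Fin 2) (Fin n → Fin 2) ℂ :=
  Matrix.of fun q x => if q = Sum.elim x 0 then 1 else 0

theorem withZerosMatrix_mulVec_ket {n a : ℕ} (x : Fin n → Fin 2) :
    (withZerosMatrix n a).mulVec (ket x) = ket (Sum.elim x 0) := by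
  ext q
  rw [mulVec_ket_apply, ket_apply, withZerosMatrix, Matrix.of_apply]

theorem eq_sumElim_zero_iff {n a : ℕ} (q : Fin n ⊕ Fin a → Fin 2) (x : Fin n → Fin 2) :
    q = Sum.elim x 0 ↔ (∀ r, q (Sum.inr r) = 0) ∧ (fun i => q (Sum.inl i)) = x := by
  constructor
  · rintro rfl
    exact ⟨fun _ => rfl, rfl⟩
  · rintro ⟨h0, rfl⟩
    ext1 i
    rcases i with i | r
    · rfl
    · exact h0 r

theorem withZeros_eq_mulVec {n a : ℕ} (ψ : QState (Fin n)) :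
    (withZeros ψ : QState (Fin n ⊕ Fin a)) =
      WithLp.toLp 2 ((withZerosMatrix n a).mulVec (WithLp.ofLp ψ)) := by
  rw [withZeros]
  congr 1
  ext q
  simp only [Matrix.mulVec, dotProduct, withZerosMatrix, Matrix.of_apply, eq_sumElim_zero_iff,
    ite_and, ite_mul, one_mul, zero_mul]
  split_ifs <;> simp

theorem tensorOne_mul_withZerosMatrix {n a : ℕ} (A : QOp (Fin n)) :
    (tensorOne A : QOp (Fin n ⊕ Fin a)) * withZerosMatrix n a = withZerosMatrix n a * A := by
  refine Matrix.ext_of_mulVec_ket fun x => ?_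
  rw [← Matrix.mulVec_mulVec, withZerosMatrix_mulVec_ket]
  ext q
  rw [mulVec_ket_apply, mulVec_ket_apply, Matrix.mul_apply]
  have h0 : ((fun r : Fin a => q (Sum.inr r)) =
      fun r => (Sum.elim x 0 : Fin n ⊕ Fin a → Fin 2) (Sum.inr r)) ↔
        ∀ r, q (Sum.inr r) = 0 := funext_iff
  simp only [tensorOne, withZerosMatrix, Matrix.of_apply, eq_sumElim_zero_iff, ite_and, ite_mul,
    one_mul, zero_mul, h0, Sum.elim_inl]
  split_ifs <;> simp

/-- The gate that flips qubit `j`, as a gate on the qubits `i` and `j`. -/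
def flipGate {Q : Type} [Fintype Q] [DecidableEq Q] (i j : Q) : QOp Q :=
  pairGate i j ((1 : Matrix (Fin 2) (Fin 2) ℂ) ⊗ₖ !![0, 1; 1, 0])

theorem flipGate_isTwoQubitGate {Q : Type} [Fintype Q] [DecidableEq Q] {i j : Q} (hij : i ≠ j) :
    IsTwoQubitGate (flipGate i j) := by
  refine pairGate_isTwoQubitGate hij (Matrix.kronecker_mem_unitary (one_mem _) ?_)
  rw [Matrix.mem_unitaryGroup_iff]
  ext a b
  fin_cases a <;> fin_cases b <;> simp [Matrix.mul_apply, Matrix.star_eq_conjTranspose]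

theorem flipGate_mulVec_ket {Q : Type} [Fintype Q] [DecidableEq Q] {i j : Q} (hij : i ≠ j)
    {q : Q → Fin 2} (hq : q j = 0) :
    (flipGate i j).mulVec (ket q) = ket (Function.update q j 1) := by
  rw [flipGate, pairGate_mulVec_ket hij, hq, Fintype.sum_prod_type,
    Finset.sum_eq_single (q i)]
  · simp [Fin.sum_univ_two]
  · intro b _ hb
    simp [hb]
  · simp

/-- The simulation of permutation-invariant Hamiltonians through the Schur transform. -/
theorem exists_circuit_evolution {n a : ℕ} (hn : 1 ≤ n) {f : YoungSite n → Fin a}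
    (hf : Function.Injective f) {H : QOp (Fin n)}
    (hH : PermutationInvariant H) (hherm : H.IsHermitian) (t : ℝ) :
    ∃ V : QCircuit (Fin n ⊕ Fin a),
      V.complexity ≤ 2 * (n * (7 * (n + 2) ^ 2) + 1) + (n + 2) * (n + 2) ^ 2 ∧
      V.toOp * withZerosMatrix n a = withZerosMatrix n a * evolution H t := by
  obtain ⟨u, hb, hu⟩ := exists_unitary_blocks_evolution hH hherm t
  let k : Fin n := ⟨0, hn⟩
  obtain ⟨W, hW, hWS⟩ := schur_implementable hf n
  obtain ⟨D, hD, hDu⟩ := Implementable.blockDiagonal hf k hu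
  rw [Fintype.card_fin] at hD
  -- Flipping one ancilla creates the particle at the empty diagram; qubit `k` is an idle partner of
  -- this gate.
  let F := QCircuit.ofGate _ (flipGate_isTwoQubitGate (i := (Sum.inl k : Fin n ⊕ Fin a))
    (j := Sum.inr (f (youngSite n 0 0))) Sum.inl_ne_inr)
  have hF : F.toOp * withZerosMatrix n a = encodeMatrix n f * atOrigin n := by
    refine Matrix.ext_of_mulVec_ket fun x => ?_
    rw [QCircuit.toOp_ofGate, ← Matrix.mulVec_mulVec, ← Matrix.mulVec_mulVec,
      withZerosMatrix_mulVec_ket, atOrigin_mulVec_ket, encodeMatrix_mulVec_ket,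
      flipGate_mulVec_ket Sum.inl_ne_inr rfl, Sum.update_elim_inr]
    rfl
  have hWF : (W.append F).toOp * withZerosMatrix n a = encodeMatrix n f * schurIsometry n := by
    rw [QCircuit.toOp_append, Matrix.mul_assoc, hF, ← Matrix.mul_assoc, hWS, Matrix.mul_assoc,
      schurIsometry]
  have hF1 : F.complexity = 1 := rfl
  -- Schur transform, blocks, then the Schur transform undone. As the blocks reproduce the image of
  -- an evolved state exactly, undoing it returns all ancillas to zero.
  refine ⟨(W.append F).inverse.append (D.append (W.append F)), ?_, ?_⟩
  · simp only [QCircuit.complexity_append, QCircuit.complexity_inverse]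
    omega
  · have h1 := Matrix.mem_unitaryGroup_iff'.1 (W.append F).toOp_mem_unitary
    rw [Matrix.star_eq_conjTranspose] at h1
    rw [QCircuit.toOp_append, QCircuit.toOp_append, QCircuit.toOp_inverse, Matrix.mul_assoc,
      Matrix.mul_assoc, hWF, ← Matrix.mul_assoc D.toOp, hDu, Matrix.mul_assoc (encodeMatrix n f),
      ← hb, ← Matrix.mul_assoc (encodeMatrix n f), ← hWF, Matrix.mul_assoc, ← Matrix.mul_assoc, h1,
      Matrix.one_mul]

theorem toEuclideanLin_sub_withZeros_eq_zero {n a : ℕ} {A : QOp (Fin n)}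
    {V : QOp (Fin n ⊕ Fin a)} (h : V * withZerosMatrix n a = withZerosMatrix n a * A)
    (ψ : QState (Fin n)) :
    Matrix.toEuclideanLin (tensorOne A - V) (withZeros ψ) = 0 := by
  rw [withZeros_eq_mulVec, Matrix.toLpLin_toLp, Matrix.toLin'_apply, Matrix.mulVec_mulVec, Matrix.sub_mul,
    tensorOne_mul_withZerosMatrix, h, sub_self, Matrix.zero_mulVec]
  rfl

/-! ### Growth rates -/

theorem isBigO_gate_count :
    (fun n : ℕ => ((2 * (n * (7 * (n + 2) ^ 2) + 1) + (n + 2) * (n + 2) ^ 2 : ℕ) : ℝ)) =O[atTop]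
      (fun n : ℕ => (n : ℝ) ^ 3) := by
  refine IsBigO.of_bound 155 ?_
  filter_upwards [eventually_ge_atTop 1] with n hn
  have hn' : (1 : ℝ) ≤ n := by exact_mod_cast hn
  rw [Real.norm_of_nonneg (Nat.cast_nonneg _), Real.norm_of_nonneg (by positivity)]
  push_cast
  have h2 : (n : ℝ) + 2 ≤ 3 * n := by linarith
  have h1 : (1 : ℝ) ≤ (n : ℝ) ^ 3 := one_le_pow₀ hn'
  calc 2 * ((n : ℝ) * (7 * (n + 2) ^ 2) + 1) + (n + 2) * (n + 2) ^ 2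
      ≤ 2 * ((n : ℝ) * (7 * (3 * n) ^ 2) + (n : ℝ) ^ 3) + (3 * n) * (3 * n) ^ 2 := by gcongr
    _ = 155 * (n : ℝ) ^ 3 := by ring

/-- Extended nonnegative reals are used because the line may a priori be infinite. -/
theorem tendsto_div_of_isBigO {G : ℕ → ℕ} {p : ℕ} {l : ℕ → ℝ≥0∞}
    (hG : (fun n => (G n : ℝ)) =O[atTop] (fun n => (n : ℝ) ^ p))
    (hl : Tendsto (fun n : ℕ => (n : ℝ≥0∞) ^ p / l n) atTop (𝓝 0)) :
    Tendsto (fun n => (G n : ℝ≥0∞) / l n) atTop (𝓝 0) := by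
  obtain ⟨c, hc⟩ := hG.bound
  have h := ENNReal.Tendsto.const_mul (a := ENNReal.ofReal c) hl (Or.inr ENNReal.ofReal_ne_top)
  rw [mul_zero] at h
  refine tendsto_of_tendsto_of_tendsto_of_le_of_le' tendsto_const_nhds h
    (Eventually.of_forall fun _ => zero_le) ?_
  filter_upwards [hc] with n hn
  rw [← mul_div_assoc]
  gcongr
  rw [Real.norm_of_nonneg (Nat.cast_nonneg _), Real.norm_of_nonneg (by positivity)] at hn
  have h2 := ENNReal.ofReal_le_ofReal hn
  rwa [ENNReal.ofReal_natCast, ENNReal.ofReal_mul' (by positivity),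
    ENNReal.ofReal_pow (Nat.cast_nonneg _), ENNReal.ofReal_natCast] at h2

theorem IsOmega.tendsto_pow_div {l : ℕ → ℕ∞} {b : ℝ} (hb : 1 < b)
    (h : IsOmega l fun n => b ^ n) (p : ℕ) :
    Tendsto (fun n : ℕ => (n : ℝ≥0∞) ^ p / (l n : ℝ≥0∞)) atTop (𝓝 0) := by
  obtain ⟨c, hc, h⟩ := h
  have h1 := (tendsto_pow_const_div_const_pow_of_one_lt p hb).const_mul c⁻¹
  rw [mul_zero] at h1
  have h2 := ENNReal.tendsto_ofReal h1
  rw [ENNReal.ofReal_zero] at h2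
  refine tendsto_of_tendsto_of_tendsto_of_le_of_le' tendsto_const_nhds h2
    (Eventually.of_forall fun _ => zero_le) ?_
  filter_upwards [h] with n hn
  have hpos : 0 < c * b ^ n := mul_pos hc (pow_pos (one_pos.trans hb) n)
  calc (n : ℝ≥0∞) ^ p / (l n : ℝ≥0∞) ≤ (n : ℝ≥0∞) ^ p / ENNReal.ofReal (c * b ^ n) := by gcongr
    _ = ENNReal.ofReal (c⁻¹ * ((n : ℝ) ^ p / b ^ n)) := by
      rw [← ENNReal.ofReal_natCast, ← ENNReal.ofReal_pow (Nat.cast_nonneg _),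
        ← ENNReal.ofReal_div_of_pos hpos]
      congr 1
      field_simp

/-- For positive `n` the factor `n` only helps, so the base 4 serves as the exponential rate. -/
theorem IsOmega.four_pow {l : ℕ → ℕ∞} (h : IsOmega l fun n => n * 2 ^ (2 * n)) :
    IsOmega l fun n => 4 ^ n := by
  obtain ⟨c, hc, h⟩ := h
  refine ⟨c, hc, ?_⟩
  filter_upwards [h, eventually_ge_atTop 1] with n hn h1
  refine le_trans (ENNReal.ofReal_le_ofReal ?_) hn
  have h1' : (1 : ℝ) ≤ n := by exact_mod_cast h1
  rw [pow_mul]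
  norm_num
  gcongr
  exact le_mul_of_one_le_left (by positivity) h1'

theorem theorem3 (k : ℕ) (g : ℕ → ℕ∞) (H : (n : ℕ) → QOp (Fin n))
    (hlocal : ∀ n, 1 ≤ n → H n ∈ LocalHamiltonians k (g n) n)
    (hperm : ∀ n, 1 ≤ n → PermutationInvariant (H n))
    (ε : ℝ) (hε : 0 < ε) :
    ∃ (V : CircuitFamily) (G : ℕ → ℕ),
      (fun n => (G n : ℝ)) =O[atTop] (fun n => (n : ℝ) ^ 3) ∧
      Simulates V H (fun _ => ⊤) (fun n => 2 ^ (2 * n)) (fun _ => ε) G ∧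
      -- fast-forwarding, whenever the line outgrows `n³`
      (Tendsto (fun n : ℕ => (n : ℝ≥0∞) ^ 3 /
          (noFastForwardingLine (fun n => LocalHamiltonians k (g n) n)
            (fun n => 2 ^ (2 * n)) (fun _ => ε) n : ℝ≥0∞)) atTop (𝓝 0) →
        FastForwards (fun n => LocalHamiltonians k (g n) n) V H (fun _ => ⊤)
          (fun n => 2 ^ (2 * n)) (fun _ => ε) G) ∧
      -- exponential fast-forwarding, whenever the line is exponential
      (∀ b : ℝ, 1 < b →
        IsOmega (noFastForwardingLine (fun n => LocalHamiltonians k (g n) n)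
          (fun n => 2 ^ (2 * n)) (fun _ => ε)) (fun n => b ^ n) →
        ExponentiallyFastForwards (fun n => LocalHamiltonians k (g n) n) V H (fun _ => ⊤)
          (fun n => 2 ^ (2 * n)) (fun _ => ε) G) ∧
      -- in particular, if the line is `Ω(n T(n))`
      (IsOmega (noFastForwardingLine (fun n => LocalHamiltonians k (g n) n)
          (fun n => 2 ^ (2 * n)) (fun _ => ε)) (fun n => n * 2 ^ (2 * n)) →
        ExponentiallyFastForwards (fun n => LocalHamiltonians k (g n) n) V H (fun _ => ⊤)
          (fun n => 2 ^ (2 * n)) (fun _ => ε) G) := by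
  have hcirc : ∀ (n : ℕ) (t : ℝ), ∃ V : QCircuit (Fin n ⊕ Fin (Fintype.card (YoungSite n))),
      1 ≤ n → V.complexity ≤ 2 * (n * (7 * (n + 2) ^ 2) + 1) + (n + 2) * (n + 2) ^ 2 ∧
        V.toOp * withZerosMatrix n (Fintype.card (YoungSite n)) =
          withZerosMatrix n (Fintype.card (YoungSite n)) * evolution (H n) t := by
    intro n t
    by_cases hn : 1 ≤ n
    · obtain ⟨V, hV⟩ :=
        exists_circuit_evolution hn (Fintype.equivFin (YoungSite n)).injective (hperm n hn)
          (LocalHamiltonians.isHermitian (hlocal n hn)) t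
      exact ⟨V, fun _ => hV⟩
    -- With no qubits there is no spectator for the gates, and nothing is claimed at `n = 0`; the
    -- empty circuit is a default.
    · exact ⟨⟨[], by simp⟩, fun h => absurd h hn⟩
  choose circuit hcircuit using hcirc
  let V : CircuitFamily := ⟨fun n => Fintype.card (YoungSite n), circuit⟩
  let G : ℕ → ℕ := fun n => 2 * (n * (7 * (n + 2) ^ 2) + 1) + (n + 2) * (n + 2) ^ 2
  have hG : (fun n => (G n : ℝ)) =O[atTop] (fun n => (n : ℝ) ^ 3) := isBigO_gate_count
  have hsim : Simulates V H (fun _ => ⊤) (fun n => 2 ^ (2 * n)) (fun _ => ε) G := by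
    intro n hn t _ _
    refine ⟨(hcircuit n t hn).1, fun ψ _ _ => ?_⟩
    -- The simulation is exact, so any positive error is admissible.
    rw [toEuclideanLin_sub_withZeros_eq_zero (hcircuit n t hn).2, norm_zero]
    exact hε.le
  have hexp : ∀ b : ℝ, 1 < b →
      IsOmega (noFastForwardingLine (fun n => LocalHamiltonians k (g n) n)
        (fun n => 2 ^ (2 * n)) (fun _ => ε)) (fun n => b ^ n) →
      ExponentiallyFastForwards (fun n => LocalHamiltonians k (g n) n) V H (fun _ => ⊤)
        (fun n => 2 ^ (2 * n)) (fun _ => ε) G := fun b hb hl =>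
    ⟨⟨hsim, tendsto_div_of_isBigO hG (hl.tendsto_pow_div hb 3)⟩, ⟨3, hG⟩, b, hb, hl⟩
  exact ⟨V, G, hG, hsim, fun hl => ⟨hsim, tendsto_div_of_isBigO hG hl⟩, hexp,
    fun hl => hexp 4 (by norm_num) hl.four_pow⟩
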